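/- **Setting.** $M\ge 1$ agents play a $d$-dimensional stochastic linear bandit ($d\ge 1$) for $T$ time steps, where $T>\max\{M,2\}$. The unknown parameter $\theta^*\in\mathbb{R}^d$ satisfies $\|\theta^*\|_2\le 1$. At time step $t$ all agents are given the same action set $\mathcal{D}_t\subseteq\{x\in\mathbb{R}^d:\|x\|_2\le 1\}$, which may vary with $t$ (and may be random and depend on the past). Agent $i$ chooses $x_{t,i}\in\mathcal{D}_t$ and observes $y_{t,i}=x_{t,i}^\top\theta^*+\eta_{t,i}$, where $\eta_{t,i}\in[-1,1]$; listing the samples in the order $(1,1),\dots,(1,M),(2,1),\dots$, each $\eta_{t,i}$ has zero conditional mean given everything generated before it, which includes all actions of step $t$ (for instance, the $\eta_{t,i}$ are independent with zero mean). The regret is $$REG(T)=\sum_{t=1}^T\sum_{i=1}^M\Bigl(\sup_{x\in\mathcal{D}_t}x^\top\theta^*-x_{t,i}^\top\theta^*\Bigr).$$ The communication cost is the number of integers and real numbers transmitted between the agents and a central server; communication happens between time steps, without latency. **The DisLinUCB protocol.** Put $\lambda=1$, $D=\frac{T\log(MT)}{dM}$, $\delta=\frac{1}{M^2T}$. Initially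 $W_{syn}=W_{new,i}=0$, $U_{syn}=U_{new,i}=0$, $t_{last}=0$. At time step $t=1,\dots,T$, each agent $i$ computes $\overline V_{t,i}=\lambda I+W_{syn}+W_{new,i}$, $\hat\theta_{t,i}=\overline V_{t,i}^{-1}(U_{syn}+U_{new,i})$ and $$\mathcal{C}_{t,i}=\Bigl\{\theta:\ \|\hat\theta_{t,i}-\theta\|_{\overline V_{t,i}}\le\sqrt{2\log\frac{\det(\overline V_{t,i})^{1/2}\det(\lambda I)^{-1/2}}{\delta}}+\lambda^{1/2}\Bigr\},\qquad \|v\|_V=\sqrt{v^\top Vv},$$ plays the $x$-component $x_{t,i}$ of a maximizer $(x_{t,i},\tilde\theta_{t,i})$ of $\langle x,\theta\rangle$ over $\mathcal{D}_t\times\mathcal{C}_{t,i}$ (ties broken arbitrarily), observes $y_{t,i}$, and adds $x_{t,i}x_{t,i}^\top$ to $W_{new,i}$ and $x_{t,i}y_{t,i}$ to $U_{new,i}$. If then, for some agent $i$, $$\log\frac{\det(\lambda I+W_{syn}+W_{new,i})}{\det(\lambda I+W_{syn})}\cdot(t-t_{last})>D,$$ a communication round takes place: every such agent sends a signal to the server,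 the server announces the round to all agents, every agent sends $W_{new,i}$ and $U_{new,i}$ ($d^2+d$ numbers) to the server, the server replaces $W_{syn}$, $U_{syn}$ by $W_{syn}+\sum_jW_{new,j}$, $U_{syn}+\sum_jU_{new,j}$ and sends both to every agent, and the agents set $W_{new,i}=0$, $U_{new,i}=0$, $t_{last}=t$. **Theorem.** There is a universal constant $C>0$ such that, whenever the actions are chosen by DisLinUCB, $$\mathbb{E}[REG(T)]\le C\,d\sqrt{MT}\,\log^2 T,$$ and the total communication cost is, on every trajectory, at most $C\,M^{3/2}d^3$; in particular this bound does not depend on $T$. -/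

import Mathlib

open MeasureTheory ProbabilityTheory
open scoped Matrix

noncomputable section

namespace DisLinUCB

/-- Vectors of `ℝ^d`, with inner product `x ⬝ᵥ y`. -/
abbrev Vec (d : ℕ) : Type := Fin d → ℝ

/-- The Euclidean norm. -/
def euclNorm {d : ℕ} (x : Vec d) : ℝ := √(x ⬝ᵥ x)

/-- The norm `‖x‖_V = √(xᵀ V x)`. -/
def matNorm {d : ℕ} (V : Matrix (Fin d) (Fin d) ℝ) (x : Vec d) : ℝ := √(x ⬝ᵥ (V *ᵥ x))

/-! ### The protocol along one trajectory

The regularization parameter is `λ = 1` throughout. Time steps are numbered `1, ..., T`; arrays of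
actions and rewards are indexed from `0`, so that `a n i`, `r n i` belong to step `n + 1`. -/

/-- The memory of the protocol between two time steps. `Wsyn`, `Usyn` are the synchronized sums
(the last values downloaded from the server, hence common to all agents); `Wnew i`, `Unew i` are
the sums over the samples that agent `i` collected since the last communication round; `tlast` is
the time step of that round. -/
structure State (M d : ℕ) where
  Wsyn : Matrix (Fin d) (Fin d) ℝ
  Usyn : Vec d
  Wnew : Fin M → Matrix (Fin d) (Fin d) ℝ
  Unew : Fin M → Vec d
  tlast : ℕ

variable {M d : ℕ}

/-- Everything is zero at the beginning. -/
def State.start (M d : ℕ) : State M d where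
  Wsyn := 0
  Usyn := 0
  Wnew := fun _ => 0
  Unew := fun _ => 0
  tlast := 0

/-- `λ I + W_syn + W_{new,i}`, the regularized Gram matrix of all samples known to agent `i`. -/
def State.V (s : State M d) (i : Fin M) : Matrix (Fin d) (Fin d) ℝ := 1 + s.Wsyn + s.Wnew i

/-- `V_last = λ I + W_syn`. -/
def State.Vlast (s : State M d) : Matrix (Fin d) (Fin d) ℝ := 1 + s.Wsyn

/-- The regularized least squares estimate of agent `i`. -/
def State.thetaHat (s : State M d) (i : Fin M) : Vec d := (s.V i)⁻¹ *ᵥ (s.Usyn + s.Unew i)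

/-- The confidence ellipsoid of agent `i` at confidence level `δ`. -/
def State.confSet (δ : ℝ) (s : State M d) (i : Fin M) : Set (Vec d) :=
  {θ | matNorm (s.V i) (s.thetaHat i - θ) ≤ √(2 * Real.log (√(s.V i).det / δ)) + 1}

/-- `x` is an optimistic action of agent `i` from the action set `A`: for some `θ'` the pair
`(x, θ')` maximizes the inner product over `A` times the confidence ellipsoid. -/
def State.IsOptimistic (δ : ℝ) (s : State M d) (i : Fin M) (A : Set (Vec d)) (x : Vec d) : Prop :=
  x ∈ A ∧ ∃ θ' ∈ s.confSet δ i, ∀ z ∈ A, ∀ θ ∈ s.confSet δ i, z ⬝ᵥ θ ≤ x ⬝ᵥ θ'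

/-- Every agent adds the sample of the current step to its local sums. -/
def State.record (s : State M d) (a : Fin M → Vec d) (r : Fin M → ℝ) : State M d :=
  { s with
    Wnew := fun i => s.Wnew i + Matrix.vecMulVec (a i) (a i)
    Unew := fun i => s.Unew i + r i • a i }

/-- Agent `i` asks for a communication round at time step `t`. -/
def State.Signals (D : ℝ) (t : ℕ) (s : State M d) (i : Fin M) : Prop :=
  D < Real.log ((s.V i).det / s.Vlast.det) * ((t : ℝ) - s.tlast)

/-- The communication round at time step `t`: the server adds all local sums to the synchronized
sums, the agents download the result and reset their local sums. -/
def State.sync (t : ℕ) (s : State M d) : State M d where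
  Wsyn := s.Wsyn + ∑ j, s.Wnew j
  Usyn := s.Usyn + ∑ j, s.Unew j
  Wnew := fun _ => 0
  Unew := fun _ => 0
  tlast := t

open Classical in
/-- Time step `t`, with actions `a` and rewards `r`: record the samples, then synchronize if some
agent asks for it. -/
def State.step (D : ℝ) (t : ℕ) (s : State M d) (a : Fin M → Vec d) (r : Fin M → ℝ) : State M d :=
  if ∃ i, (s.record a r).Signals D t i then (s.record a r).sync t else s.record a r

/-- The state after `n` time steps. -/
def stateAfter (D : ℝ) (a : ℕ → Fin M → Vec d) (r : ℕ → Fin M → ℝ) : ℕ → State M d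
  | 0 => State.start M d
  | n + 1 => (stateAfter D a r n).step D (n + 1) (a n) (r n)

open Classical in
/-- The number of integers and real numbers transmitted at the end of time step `t`, where `s` is
the state after recording. If some agent signals, there are: one number for each signalling agent;
one for each agent, by which the server announces the round; the upload of `W_{new,i}`, `U_{new,i}`
by each agent; and the download of `W_syn`, `U_syn` by each agent. Otherwise nothing is sent. -/
def State.commCost (D : ℝ) (t : ℕ) (s : State M d) : ℕ :=
  if ∃ i, s.Signals D t i then
    (Finset.univ.filter fun i => s.Signals D t i).card + M + M * (d ^ 2 + d) + M * (d ^ 2 + d)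
  else 0

/-- The communication cost of `T` time steps. -/
def commCost (D : ℝ) (T : ℕ) (a : ℕ → Fin M → Vec d) (r : ℕ → Fin M → ℝ) : ℕ :=
  ∑ n ∈ Finset.range T, ((stateAfter D a r n).record (a n) (r n)).commCost D (n + 1)

/-- The synchronization threshold `D = T log(MT) / (dM)`. -/
def threshold (M d T : ℕ) : ℝ := (T : ℝ) * Real.log (M * T) / (d * M)

/-- The confidence parameter `δ = 1 / (M² T)`. -/
def confLevel (M T : ℕ) : ℝ := 1 / ((M : ℝ) ^ 2 * T)

/-! ### The bandit problem -/

/-- The rewards `y = xᵀ θ* + η`. -/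
def reward {Ω : Type*} (θstar : Vec d) (x : ℕ → Fin M → Ω → Vec d) (η : ℕ → Fin M → Ω → ℝ)
    (ω : Ω) (n : ℕ) (i : Fin M) : ℝ :=
  x n i ω ⬝ᵥ θstar + η n i ω

/-- The best expected reward over the action set `A`. -/
def bestValue (θstar : Vec d) (A : Set (Vec d)) : ℝ := sSup ((fun z => z ⬝ᵥ θstar) '' A)

/-- The cumulative (pseudo-)regret of all agents over `T` time steps. -/
def regret {Ω : Type*} (T : ℕ) (θstar : Vec d) (A : ℕ → Ω → Set (Vec d))
    (x : ℕ → Fin M → Ω → Vec d) (ω : Ω) : ℝ :=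
  ∑ n ∈ Finset.range T, ∑ i, (bestValue θstar (A n ω) - x n i ω ⬝ᵥ θstar)

/-- A distributed linear bandit problem over `T` time steps with time-varying (possibly random and
history-dependent) action sets `A n`, noise `η` and actions `x`. The filtration lists the samples
in the order `(1,1), ..., (1,M), (2,1), ...`: `ℱ (n * M + i)` is the information generated before
the noise of agent `i` in step `n + 1`, and the actions of all agents in step `n + 1` use only
`ℱ (n * M)`. Independent zero-mean noise is a special case. -/
structure IsLinearBandit {Ω : Type*} {mΩ : MeasurableSpace Ω} (μ : Measure Ω)
    (ℱ : Filtration ℕ mΩ) (T : ℕ) (θstar : Vec d) (A : ℕ → Ω → Set (Vec d))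
    (η : ℕ → Fin M → Ω → ℝ) (x : ℕ → Fin M → Ω → Vec d) : Prop where
  theta_le : euclNorm θstar ≤ 1
  action_le : ∀ n < T, ∀ ω, ∀ z ∈ A n ω, euclNorm z ≤ 1
  best_meas : ∀ n < T, Measurable fun ω => bestValue θstar (A n ω)
  action_meas : ∀ n < T, ∀ i, Measurable[ℱ (n * M)] (x n i)
  noise_meas : ∀ n < T, ∀ i : Fin M, Measurable[ℱ (n * M + i + 1)] (η n i)
  noise_mem : ∀ n < T, ∀ i, ∀ ω, η n i ω ∈ Set.Icc (-1 : ℝ) 1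
  noise_mean : ∀ n < T, ∀ i : Fin M, μ[η n i | ℱ (n * M + i)] =ᵐ[μ] 0

/-- The agents follow DisLinUCB (ties in the maximization may be broken arbitrarily). -/
def FollowsDisLinUCB {Ω : Type*} (T : ℕ) (θstar : Vec d) (A : ℕ → Ω → Set (Vec d))
    (η : ℕ → Fin M → Ω → ℝ) (x : ℕ → Fin M → Ω → Vec d) : Prop :=
  ∀ n < T, ∀ i, ∀ ω,
    (stateAfter (threshold M d T) (fun m j => x m j ω) (reward θstar x η ω) n).IsOptimistic
      (confLevel M T) i (A n ω) (x n i ω)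

end DisLinUCB

end

/-! Write `L = log(MT)`. An epoch is the stretch between two communication rounds.

Confidence. For the Gram matrix `V` and the noise sum `S` of predictably selected samples, the
process `exp(SᵀV⁻¹S/2)/√det V` has increments bounded pathwise by noise times a slope known in
advance (`selfNorm_add_le`), so a Ville inequality controls it at all times simultaneously. What an
agent knows is not a fixed set of samples, but it is determined by the agent and the number of
rounds so far, and rounds are triggered by actions only. For a fixed round number `p` and agent `i`,
"collected before round `p` or by `i`" is therefore a predictable selection. A union bound over the
`O(d√M)` possible `p` and the `M` agents suffices; the failure probability times the trivial regret
`2MT` is `O(d√M)`.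

Regret. On the good event, optimism bounds each regret term by `min(2, B√w)`, where `w = xᵀV⁻¹x` for
the agent's own `V` and `B` is of order `√(dL)`. The log-determinant of all `MT` samples is at most
`R = 2dL`, so at most `R` epochs raise it by more than 1. In every other epoch the agent's
determinant is within a factor `e` of that of all earlier samples, so `w` is at most 3 times the
centralized width; the elliptical potential lemma and Cauchy–Schwarz over all agents and steps give
`B√(6MTR)`. In an exceptional epoch the trigger rule keeps (length) × (log-determinant gain) below
`D` for each agent until the last step, so an agent pays at most `B√(2D) + 2`. The value of `D`
makes the exceptional total `O(d√(MT)L²)`; the two parts meet in `sum_le_of_le_width`.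

Communication. A round needs (length) × (gain) `> D`, hence by AM–GM `c·length + gain/c > 2√D`.
Lengths add up to at most `T` and gains to at most `R`, so a suitable `c` gives `O(d√M)` rounds
(`rounds_le`), each costing `O(Md²)` numbers. -/

namespace DisLinUCB

open Matrix Finset

/-! ### Rank-one updates, determinants and quadratic forms of Gram matrices. -/

section LinearAlgebra

variable {d : ℕ} {ι : Type*}

/-- The quadratic form `xᵀ V⁻¹ x`. -/
noncomputable def invQuad (V : Matrix (Fin d) (Fin d) ℝ) (x : Vec d) : ℝ := x ⬝ᵥ (V⁻¹ *ᵥ x)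

/-- The regularized Gram matrix `I + ∑ u_k u_kᵀ`. -/
noncomputable def gram (u : ι → Vec d) (s : Finset ι) : Matrix (Fin d) (Fin d) ℝ :=
  1 + ∑ k ∈ s, vecMulVec (u k) (u k)

lemma posDef_gram (u : ι → Vec d) (s : Finset ι) : (gram u s).PosDef :=
  PosDef.one.add_posSemidef <| posSemidef_sum s fun k _ => by
    simpa using posSemidef_vecMulVec_self_star (u k)

lemma gram_insert [DecidableEq ι] (u : ι → Vec d) {s : Finset ι} {k : ι} (hk : k ∉ s) :
    gram u (insert k s) = gram u s + vecMulVec (u k) (u k) := by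
  rw [gram, gram, sum_insert hk]; abel

lemma gram_empty (u : ι → Vec d) : gram u ∅ = 1 := by simp [gram]

variable {V : Matrix (Fin d) (Fin d) ℝ}

lemma _root_.Matrix.PosDef.add_vecMulVec (hV : V.PosDef) (x : Vec d) :
    (V + vecMulVec x x).PosDef :=
  hV.add_posSemidef (by simpa using posSemidef_vecMulVec_self_star x)

lemma dotProduct_mulVec_comm (hV : V.PosDef) (x y : Vec d) : x ⬝ᵥ V *ᵥ y = y ⬝ᵥ V *ᵥ x := by
  have h : Vᵀ = V := by simpa using hV.isHermitian.eq
  rw [dotProduct_mulVec, ← mulVec_transpose, h, dotProduct_comm]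

lemma mulVec_inv_mulVec (hV : V.PosDef) (x : Vec d) : V *ᵥ (V⁻¹ *ᵥ x) = x := by
  rw [mulVec_mulVec, mul_nonsing_inv _ hV.det_pos.ne'.isUnit, one_mulVec]

lemma inv_mulVec_mulVec (hV : V.PosDef) (x : Vec d) : V⁻¹ *ᵥ (V *ᵥ x) = x := by
  rw [mulVec_mulVec, nonsing_inv_mul _ hV.det_pos.ne'.isUnit, one_mulVec]

lemma quad_nonneg (hV : V.PosDef) (x : Vec d) : 0 ≤ x ⬝ᵥ V *ᵥ x := by
  simpa using hV.posSemidef.dotProduct_mulVec_nonneg x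

lemma invQuad_nonneg (hV : V.PosDef) (x : Vec d) : 0 ≤ invQuad V x := quad_nonneg hV.inv x

/-- The Cauchy–Schwarz inequality for the inner product of a positive definite matrix. -/
lemma dotProduct_mulVec_sq_le (hV : V.PosDef) (x y : Vec d) :
    (x ⬝ᵥ V *ᵥ y) ^ 2 ≤ (x ⬝ᵥ V *ᵥ x) * (y ⬝ᵥ V *ᵥ y) := by
  have h := LinearMap.BilinForm.apply_sq_le_of_symm (Matrix.toBilin' V)
    (fun z => by simpa [Matrix.toBilin'_apply'] using quad_nonneg hV z)
    ⟨fun z w => by simpa [Matrix.toBilin'_apply'] using dotProduct_mulVec_comm hV z w⟩ x y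
  simpa [Matrix.toBilin'_apply'] using h

lemma matNorm_add_le (hV : V.PosDef) (x y : Vec d) :
    matNorm V (x + y) ≤ matNorm V x + matNorm V y := by
  have hx := quad_nonneg hV x
  have hy := quad_nonneg hV y
  refine Real.sqrt_le_iff.2 ⟨by unfold matNorm; positivity, ?_⟩
  have h1 : x ⬝ᵥ V *ᵥ y ≤ matNorm V x * matNorm V y := by
    rw [matNorm, matNorm, ← Real.sqrt_mul hx]
    exact Real.le_sqrt_of_sq_le (dotProduct_mulVec_sq_le hV x y)
  have h2 : matNorm V x ^ 2 = x ⬝ᵥ V *ᵥ x := Real.sq_sqrt hx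
  have h3 : matNorm V y ^ 2 = y ⬝ᵥ V *ᵥ y := Real.sq_sqrt hy
  rw [mulVec_add, dotProduct_add, add_dotProduct, add_dotProduct, dotProduct_mulVec_comm hV y x]
  nlinarith

lemma matNorm_neg (x : Vec d) : matNorm V (-x) = matNorm V x := by
  simp [matNorm, mulVec_neg]

lemma matNorm_inv_mulVec (hV : V.PosDef) (x : Vec d) :
    matNorm V (V⁻¹ *ᵥ x) = √(invQuad V x) := by
  rw [matNorm, mulVec_inv_mulVec hV, dotProduct_comm, invQuad]

lemma matNorm_inv (x : Vec d) : matNorm V⁻¹ x = √(invQuad V x) := rfl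

lemma dotProduct_le_matNorm (hV : V.PosDef) (x v : Vec d) :
    x ⬝ᵥ v ≤ √(invQuad V x) * matNorm V v := by
  have h := dotProduct_mulVec_sq_le hV (V⁻¹ *ᵥ x) v
  rw [dotProduct_mulVec_comm hV, mulVec_inv_mulVec hV, dotProduct_comm v,
    dotProduct_comm (V⁻¹ *ᵥ x)] at h
  rw [matNorm, ← Real.sqrt_mul (invQuad_nonneg hV x)]
  exact Real.le_sqrt_of_sq_le h

/-- The matrix determinant lemma for a symmetric rank-one update. -/
lemma det_add_vecMulVec (hV : V.PosDef) (x : Vec d) :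
    (V + vecMulVec x x).det = V.det * (1 + invQuad V x) := by
  rw [vecMulVec_eq Unit, det_add_replicateCol_mul_replicateRow hV.det_pos.ne'.isUnit]
  congr 1
  rw [det_unique, Matrix.add_apply, Matrix.one_apply_eq, Matrix.mul_assoc]
  simp [invQuad, Matrix.mul_apply, dotProduct, mulVec]

/-- The Sherman–Morrison formula. -/
lemma inv_add_vecMulVec_mulVec (hV : V.PosDef) (x y : Vec d) :
    (V + vecMulVec x x)⁻¹ *ᵥ y =
      V⁻¹ *ᵥ y - ((x ⬝ᵥ V⁻¹ *ᵥ y) / (1 + invQuad V x)) • V⁻¹ *ᵥ x := by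
  have hw := invQuad_nonneg hV x
  set z := V⁻¹ *ᵥ y - ((x ⬝ᵥ V⁻¹ *ᵥ y) / (1 + invQuad V x)) • V⁻¹ *ᵥ x with hz
  have h : (V + vecMulVec x x) *ᵥ z = y := by
    rw [hz, mulVec_sub, mulVec_smul, add_mulVec, add_mulVec, mulVec_inv_mulVec hV,
      mulVec_inv_mulVec hV, vecMulVec_mulVec, vecMulVec_mulVec]
    rw [show x ⬝ᵥ V⁻¹ *ᵥ x = invQuad V x from rfl]
    ext i
    simp
    field_simp
    ring
  rw [← inv_mulVec_mulVec (hV.add_vecMulVec x) z, h]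

lemma dotProduct_inv_add_vecMulVec (hV : V.PosDef) (x y z : Vec d) :
    z ⬝ᵥ (V + vecMulVec x x)⁻¹ *ᵥ y =
      z ⬝ᵥ V⁻¹ *ᵥ y - (x ⬝ᵥ V⁻¹ *ᵥ y) * (z ⬝ᵥ V⁻¹ *ᵥ x) / (1 + invQuad V x) := by
  rw [inv_add_vecMulVec_mulVec hV, dotProduct_sub, dotProduct_smul, smul_eq_mul]
  ring

lemma invQuad_add_vecMulVec (hV : V.PosDef) (x y : Vec d) :
    invQuad (V + vecMulVec x x) y = invQuad V y - (x ⬝ᵥ V⁻¹ *ᵥ y) ^ 2 / (1 + invQuad V x) := by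
  rw [invQuad, dotProduct_inv_add_vecMulVec hV, dotProduct_mulVec_comm hV.inv y x]
  simp only [invQuad]
  ring

lemma invQuad_add_vecMulVec_le (hV : V.PosDef) (x y : Vec d) :
    invQuad (V + vecMulVec x x) y ≤ invQuad V y := by
  have := invQuad_nonneg hV x
  rw [invQuad_add_vecMulVec hV]
  have : 0 ≤ (x ⬝ᵥ V⁻¹ *ᵥ y) ^ 2 / (1 + invQuad V x) := by positivity
  linarith

/-- The quadratic form of the adjugate grows under rank-one updates: the determinant lemma and
Sherman–Morrison reduce the difference to Cauchy–Schwarz for `V⁻¹`. It turns a bound on a ratio of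
determinants into a bound on a ratio of widths. -/
lemma det_mul_invQuad_le_add_vecMulVec (hV : V.PosDef) (x y : Vec d) :
    V.det * invQuad V y ≤ (V + vecMulVec x x).det * invQuad (V + vecMulVec x x) y := by
  have hx := invQuad_nonneg hV x
  have h : (x ⬝ᵥ V⁻¹ *ᵥ y) ^ 2 ≤ invQuad V x * invQuad V y := dotProduct_mulVec_sq_le hV.inv x y
  rw [det_add_vecMulVec hV, invQuad_add_vecMulVec hV, mul_assoc]
  refine mul_le_mul_of_nonneg_left ?_ hV.det_pos.le
  rw [mul_sub, mul_div_cancel₀ _ (by positivity)]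
  linarith

/-- Enlarging the index set is a chain of rank-one updates, so each monotonicity statement needs to
be checked for one update only. -/
lemma gram_induction [DecidableEq ι] (u : ι → Vec d) {s t : Finset ι} (hst : s ⊆ t)
    (P : Matrix (Fin d) (Fin d) ℝ → Prop) (h0 : P (gram u s))
    (h1 : ∀ V k, V.PosDef → P V → P (V + vecMulVec (u k) (u k))) : P (gram u t) := by
  rw [← union_sdiff_of_subset hst]
  have : Disjoint s (t \ s) := disjoint_sdiff
  generalize t \ s = r at this
  induction r using Finset.induction_on with
  | empty => simpa
  | insert k r hk ih =>
    rw [disjoint_insert_right] at this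
    rw [union_insert, gram_insert _ (by simp [hk, this.1])]
    exact h1 _ _ (posDef_gram _ _) (ih this.2)

lemma det_gram_mono [DecidableEq ι] (u : ι → Vec d) {s t : Finset ι} (hst : s ⊆ t) :
    (gram u s).det ≤ (gram u t).det :=
  gram_induction u hst (fun V => (gram u s).det ≤ V.det) le_rfl fun V k hV h => by
    rw [det_add_vecMulVec hV]
    nlinarith [invQuad_nonneg hV (u k), hV.det_pos]

lemma invQuad_gram_anti [DecidableEq ι] (u : ι → Vec d) {s t : Finset ι} (hst : s ⊆ t)
    (x : Vec d) : invQuad (gram u t) x ≤ invQuad (gram u s) x :=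
  gram_induction u hst (fun V => invQuad V x ≤ invQuad (gram u s) x) le_rfl fun _ _ hV h =>
    (invQuad_add_vecMulVec_le hV _ _).trans h

lemma det_mul_invQuad_gram_mono [DecidableEq ι] (u : ι → Vec d) {s t : Finset ι} (hst : s ⊆ t)
    (x : Vec d) :
    (gram u s).det * invQuad (gram u s) x ≤ (gram u t).det * invQuad (gram u t) x :=
  gram_induction u hst
    (fun V => (gram u s).det * invQuad (gram u s) x ≤ V.det * invQuad V x) le_rfl
    fun _ _ hV h => h.trans (det_mul_invQuad_le_add_vecMulVec hV _ _)

lemma invQuad_gram_le_dotProduct [DecidableEq ι] (u : ι → Vec d) (s : Finset ι) (x : Vec d) :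
    invQuad (gram u s) x ≤ x ⬝ᵥ x := by
  simpa [gram_empty, invQuad] using invQuad_gram_anti u (empty_subset s) x

/-- The tangent line of `log` at `1 + #s` bounds each log-eigenvalue; summing leaves only the trace,
which is at most `d + #s ≤ d(1 + #s)` when `d ≥ 1`. -/
lemma log_det_gram_le (u : ι → Vec d) (s : Finset ι) (hu : ∀ k ∈ s, u k ⬝ᵥ u k ≤ 1) :
    Real.log (gram u s).det ≤ d * Real.log (1 + #s) := by
  have hP := posDef_gram u s
  have htr : (gram u s).trace ≤ d + #s := by
    rw [gram, trace_add, trace_one, trace_sum, Fintype.card_fin]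
    have : ∑ k ∈ s, (vecMulVec (u k) (u k)).trace ≤ ∑ k ∈ s, 1 :=
      sum_le_sum fun k hk => by simpa [trace_vecMulVec] using hu k hk
    simp at this ⊢
    linarith
  have hdet := hP.isHermitian.det_eq_prod_eigenvalues
  have htr' := hP.isHermitian.trace_eq_sum_eigenvalues
  simp only [RCLike.ofReal_real_eq_id, id_eq] at hdet htr'
  have hpos := hP.eigenvalues_pos
  rw [hdet, Real.log_prod fun i _ => (hpos i).ne']
  have hμ : (0 : ℝ) < 1 + #s := by positivity
  calc ∑ i, Real.log (hP.isHermitian.eigenvalues i)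
      ≤ ∑ i, (Real.log (1 + #s) + (hP.isHermitian.eigenvalues i / (1 + #s) - 1)) := by
        refine sum_le_sum fun i _ => ?_
        have := Real.log_le_sub_one_of_pos (div_pos (hpos i) hμ)
        rw [Real.log_div (hpos i).ne' hμ.ne'] at this
        linarith
    _ = d * Real.log (1 + #s) + ((gram u s).trace / (1 + #s) - d) := by
        rw [sum_add_distrib, sum_sub_distrib, ← sum_div, ← htr']
        simp
    _ ≤ d * Real.log (1 + #s) := by
        have h : (gram u s).trace / (1 + #s) ≤ d := by
          rw [div_le_iff₀ hμ]
          rcases Nat.eq_zero_or_pos d with rfl | hd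
          · simp
          · have : (1 : ℝ) ≤ d := by exact_mod_cast hd
            nlinarith [(Nat.cast_nonneg (#s) : (0 : ℝ) ≤ _)]
        linarith

lemma min_one_le_two_mul_log {w : ℝ} (hw : 0 ≤ w) : min 1 w ≤ 2 * Real.log (1 + w) := by
  have h := Real.one_sub_inv_le_log_of_pos (show 0 < 1 + min 1 w by positivity)
  have hm : Real.log (1 + min 1 w) ≤ Real.log (1 + w) :=
    Real.log_le_log (by positivity) (by gcongr; exact min_le_right _ _)
  have h2 : min 1 w / 2 ≤ 1 - (1 + min 1 w)⁻¹ := by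
    have h0 : 0 ≤ min 1 w := by positivity
    have h1 : min 1 w ≤ 1 := min_le_left _ _
    generalize min 1 w = m at *
    rw [← sub_nonneg, show 1 - (1 + m)⁻¹ - m / 2 = m * (1 - m) / (2 * (1 + m)) by field_simp; ring]
    have : 0 ≤ 1 - m := by linarith
    positivity
  linarith

end LinearAlgebra

/-! ### One step of the self-normalized process. -/

section SelfNormalized

variable {d : ℕ}

/-- The exponent is convex in `e` because `w ≥ 0`, so its exponential lies below the chord between
`e = -1` and `e = 1`. In use, `u = zᵀV⁻¹S` and `w = zᵀV⁻¹z`. -/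
lemma exp_quadratic_le_chord {u w e : ℝ} (hw : 0 ≤ w) (he : e ∈ Set.Icc (-1 : ℝ) 1) :
    Real.exp ((-u ^ 2 + 2 * e * u + e ^ 2 * w) / (2 * (1 + w))) ≤
      (1 + e) / 2 * Real.exp ((-u ^ 2 + 2 * u + w) / (2 * (1 + w))) +
        (1 - e) / 2 * Real.exp ((-u ^ 2 - 2 * u + w) / (2 * (1 + w))) := by
  obtain ⟨h1, h2⟩ := he
  have hconv := convexOn_exp.2 (Set.mem_univ ((-u ^ 2 + 2 * u + w) / (2 * (1 + w))))
    (Set.mem_univ ((-u ^ 2 - 2 * u + w) / (2 * (1 + w)))) (show 0 ≤ (1 + e) / 2 by linarith)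
    (show 0 ≤ (1 - e) / 2 by linarith) (by ring)
  simp only [smul_eq_mul] at hconv
  refine le_trans (Real.exp_le_exp.2 ?_) hconv
  rw [← mul_div_assoc, ← mul_div_assoc, ← add_div]
  refine div_le_div_of_nonneg_right ?_ (by positivity)
  nlinarith [mul_nonneg hw (show 0 ≤ 1 - e ^ 2 by nlinarith)]

/-- The case of a fair random sign: the average growth is at most `√(1 + w)`, exactly the growth of
`√det V`. It follows from `cosh y ≤ exp(y²/2)` and `w/(1 + w) ≤ log(1 + w)`. -/
lemma exp_add_exp_le_sqrt {u w : ℝ} (hw : 0 ≤ w) :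
    Real.exp ((-u ^ 2 + 2 * u + w) / (2 * (1 + w))) +
      Real.exp ((-u ^ 2 - 2 * u + w) / (2 * (1 + w))) ≤ 2 * √(1 + w) := by
  have hw1 : 0 < 1 + w := by positivity
  have h1 : (-u ^ 2 + 2 * u + w) / (2 * (1 + w)) =
      (w - u ^ 2) / (2 * (1 + w)) + u / (1 + w) := by field_simp; ring
  have h2 : (-u ^ 2 - 2 * u + w) / (2 * (1 + w)) =
      (w - u ^ 2) / (2 * (1 + w)) + -(u / (1 + w)) := by field_simp; ring
  rw [h1, h2, Real.exp_add, Real.exp_add, ← mul_add,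
    show Real.exp (u / (1 + w)) + Real.exp (-(u / (1 + w))) = 2 * Real.cosh (u / (1 + w)) by
      rw [Real.cosh_eq]; ring]
  have h3 : Real.exp ((w - u ^ 2) / (2 * (1 + w))) * Real.cosh (u / (1 + w)) ≤ √(1 + w) := by
    calc _ ≤ Real.exp ((w - u ^ 2) / (2 * (1 + w))) * Real.exp ((u / (1 + w)) ^ 2 / 2) := by
          gcongr; exact Real.cosh_le_exp_half_sq _
      _ = Real.exp (w / (1 + w) / 2 - u ^ 2 * w / (2 * (1 + w) ^ 2)) := by
          rw [← Real.exp_add]; congr 1; field_simp; ring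
      _ ≤ Real.exp (Real.log (1 + w) / 2) := by
          refine Real.exp_le_exp.2 ?_
          have := Real.one_sub_inv_le_log_of_pos hw1
          have h4 : 1 - (1 + w)⁻¹ = w / (1 + w) := by field_simp; ring
          have h5 : 0 ≤ u ^ 2 * w / (2 * (1 + w) ^ 2) := by positivity
          linarith
      _ = √(1 + w) := by
          rw [Real.sqrt_eq_rpow, Real.rpow_def_of_pos hw1]; congr 1; ring
  linarith

/-- The value of the self-normalized process for the Gram matrix `V` and the noise sum `S`. -/
noncomputable def selfNorm (V : Matrix (Fin d) (Fin d) ℝ) (S : Vec d) : ℝ :=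
  Real.exp (invQuad V S / 2) / √V.det

/-- The slope of the linear upper bound for the increment of `selfNorm` along the sample `z`. -/
noncomputable def selfNormSlope (V : Matrix (Fin d) (Fin d) ℝ) (S z : Vec d) : ℝ :=
  (selfNorm (V + vecMulVec z z) (S + z) - selfNorm (V + vecMulVec z z) (S - z)) / 2

variable {V : Matrix (Fin d) (Fin d) ℝ}

lemma selfNorm_nonneg (V : Matrix (Fin d) (Fin d) ℝ) (S : Vec d) : 0 ≤ selfNorm V S := by
  unfold selfNorm; positivity

lemma selfNorm_add (hV : V.PosDef) (S z : Vec d) (e : ℝ) :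
    selfNorm (V + vecMulVec z z) (S + e • z) = selfNorm V S *
      (Real.exp ((-(z ⬝ᵥ V⁻¹ *ᵥ S) ^ 2 + 2 * e * (z ⬝ᵥ V⁻¹ *ᵥ S) + e ^ 2 * invQuad V z) /
        (2 * (1 + invQuad V z))) / √(1 + invQuad V z)) := by
  have hw := invQuad_nonneg hV z
  have hd := hV.det_pos
  have h : invQuad (V + vecMulVec z z) (S + e • z) / 2 = invQuad V S / 2 +
      (-(z ⬝ᵥ V⁻¹ *ᵥ S) ^ 2 + 2 * e * (z ⬝ᵥ V⁻¹ *ᵥ S) + e ^ 2 * invQuad V z) /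
        (2 * (1 + invQuad V z)) := by
    rw [invQuad_add_vecMulVec hV]
    simp only [invQuad, mulVec_add, mulVec_smul, dotProduct_add, add_dotProduct, smul_dotProduct,
      dotProduct_smul, smul_eq_mul, dotProduct_mulVec_comm hV.inv S z] at hw ⊢
    generalize z ⬝ᵥ V⁻¹ *ᵥ z = w at *
    field_simp
    ring
  rw [selfNorm, selfNorm, h, Real.exp_add, det_add_vecMulVec hV, Real.sqrt_mul hd.le,
    mul_div_mul_comm]

lemma selfNorm_add_self (hV : V.PosDef) (S z : Vec d) :
    selfNorm (V + vecMulVec z z) (S + z) = selfNorm V S *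
      (Real.exp ((-(z ⬝ᵥ V⁻¹ *ᵥ S) ^ 2 + 2 * (z ⬝ᵥ V⁻¹ *ᵥ S) + invQuad V z) /
        (2 * (1 + invQuad V z))) / √(1 + invQuad V z)) := by
  simpa using selfNorm_add hV S z 1

lemma selfNorm_sub_self (hV : V.PosDef) (S z : Vec d) :
    selfNorm (V + vecMulVec z z) (S - z) = selfNorm V S *
      (Real.exp ((-(z ⬝ᵥ V⁻¹ *ᵥ S) ^ 2 - 2 * (z ⬝ᵥ V⁻¹ *ᵥ S) + invQuad V z) /
        (2 * (1 + invQuad V z))) / √(1 + invQuad V z)) := by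
  simpa [← sub_eq_add_neg] using selfNorm_add hV S z (-1)

/-- The bound is affine in the noise with a slope fixed before the noise is drawn, so only a zero
conditional mean is needed to make the process a supermartingale. The chord bound gives the slope,
the random-sign bound the constant term. -/
lemma selfNorm_add_le (hV : V.PosDef) (S z : Vec d) {e : ℝ} (he : e ∈ Set.Icc (-1 : ℝ) 1) :
    selfNorm (V + vecMulVec z z) (S + e • z) ≤ selfNorm V S + e * selfNormSlope V S z := by
  have hw := invQuad_nonneg hV z
  have h3 := exp_quadratic_le_chord (u := z ⬝ᵥ V⁻¹ *ᵥ S) hw he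
  have h4 := exp_add_exp_le_sqrt (u := z ⬝ᵥ V⁻¹ *ᵥ S) hw
  have h0 := selfNorm_nonneg V S
  rw [selfNormSlope, selfNorm_add hV, selfNorm_add_self hV, selfNorm_sub_self hV]
  have hs : 0 < √(1 + invQuad V z) := by positivity
  generalize √(1 + invQuad V z) = s at *
  set x := Real.exp ((-(z ⬝ᵥ V⁻¹ *ᵥ S) ^ 2 + 2 * (z ⬝ᵥ V⁻¹ *ᵥ S) + invQuad V z) /
        (2 * (1 + invQuad V z)))
  set y := Real.exp ((-(z ⬝ᵥ V⁻¹ *ᵥ S) ^ 2 - 2 * (z ⬝ᵥ V⁻¹ *ᵥ S) + invQuad V z) /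
        (2 * (1 + invQuad V z)))
  calc _ ≤ selfNorm V S * ((s + e * (x - y) / 2) / s) := by gcongr; linarith
    _ = _ := by field_simp

/-- As long as the process has not crossed a level, its slope is bounded by that level; this is the
integrability used when stopping. Both endpoint values are nonnegative and their mean is at most
`selfNorm V S`. -/
lemma abs_selfNormSlope_le (hV : V.PosDef) (S z : Vec d) :
    |selfNormSlope V S z| ≤ selfNorm V S := by
  have hw := invQuad_nonneg hV z
  have h0 := selfNorm_nonneg V S
  have h5 := selfNorm_nonneg (V + vecMulVec z z) (S + z)
  have h6 := selfNorm_nonneg (V + vecMulVec z z) (S - z)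
  have : selfNorm (V + vecMulVec z z) (S + z) + selfNorm (V + vecMulVec z z) (S - z) ≤
      selfNorm V S * 2 := by
    rw [selfNorm_add_self hV, selfNorm_sub_self hV, ← mul_add, ← add_div]
    refine mul_le_mul_of_nonneg_left ?_ h0
    rw [div_le_iff₀ (by positivity)]
    exact exp_add_exp_le_sqrt hw
  rw [selfNormSlope, abs_le]
  constructor <;> linarith

end SelfNormalized

/-! ### A maximal inequality by stopping. -/

section Ville

variable {Ω : Type*} {mΩ : MeasurableSpace Ω} {μ : Measure Ω} [IsProbabilityMeasure μ]

lemma integral_mul_eq_zero_of_condExp {m : MeasurableSpace Ω} (hm : m ≤ mΩ) {g e : Ω → ℝ} {c : ℝ}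
    (hg : Measurable[m] g) (hgc : ∀ ω, |g ω| ≤ c) (he : Integrable e μ)
    (h0 : μ[e | m] =ᵐ[μ] 0) : ∫ ω, g ω * e ω ∂μ = 0 := by
  have h := condExp_stronglyMeasurable_mul_of_bound hm (μ := μ) hg.stronglyMeasurable he c
    (.of_forall hgc)
  calc ∫ ω, g ω * e ω ∂μ = ∫ ω, (μ[g * e | m]) ω ∂μ := (integral_condExp hm).symm
    _ = ∫ _, (0 : ℝ) ∂μ := integral_congr_ae <| by
        filter_upwards [h, h0] with ω h1 h2
        simp [h1, h2]
    _ = 0 := by simp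

/-- A maximal inequality of Ville type for a nonnegative process whose increments are dominated
pathwise by a martingale difference. -/
theorem mul_measureReal_exists_le {ℱ : Filtration ℕ mΩ} {n : ℕ} {N e g : ℕ → Ω → ℝ} {c : ℝ}
    (hN0 : ∀ ω, N 0 ω ≤ 1) (hc : 1 ≤ c) (hN : ∀ k ≤ n, Measurable[ℱ k] (N k))
    (hNpos : ∀ k ω, 0 ≤ N k ω)
    (hg : ∀ k < n, Measurable[ℱ k] (g k)) (he : ∀ k < n, Measurable (e k))
    (he1 : ∀ k < n, ∀ ω, |e k ω| ≤ 1) (he0 : ∀ k < n, μ[e k | ℱ k] =ᵐ[μ] 0)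
    (hgN : ∀ k < n, ∀ ω, |g k ω| ≤ N k ω)
    (hstep : ∀ k < n, ∀ ω, N (k + 1) ω ≤ N k ω + e k ω * g k ω) :
    c * μ.real {ω | ∃ k ≤ n, c ≤ N k ω} ≤ 1 := by
  classical
  set A : ℕ → Set Ω := fun k => {ω | ∃ m ≤ k, c ≤ N m ω} with hA
  have hAm : ∀ k ≤ n, MeasurableSet[ℱ k] (A k) := fun k hk => by
    have : A k = ⋃ m, ⋃ (_ : m ≤ k), {ω | c ≤ N m ω} := by ext; simp [hA]
    rw [this]
    refine MeasurableSet.iUnion fun m => MeasurableSet.iUnion fun hm => ?_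
    exact ℱ.mono hm _ (measurableSet_le measurable_const (hN m (hm.trans hk)))
  -- The process frozen at `c` from its first crossing on. It takes values in `[0, c]`, so the
  -- process itself need not be assumed integrable.
  set Φ : ℕ → Ω → ℝ := fun k ω => if ω ∈ A k then c else N k ω with hΦ
  have hΦm : ∀ k ≤ n, Measurable (Φ k) := fun k hk =>
    Measurable.ite (ℱ.le k _ (hAm k hk)) measurable_const ((hN k hk).mono (ℱ.le k) le_rfl)
  have hlt : ∀ k ω, ω ∉ A k → N k ω < c := fun k ω h => by
    by_contra! h'
    exact h ⟨k, le_rfl, h'⟩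
  have hΦ0 : ∀ k ω, 0 ≤ Φ k ω := fun k ω => by
    simp only [hΦ]; split_ifs
    · linarith
    · exact hNpos k ω
  have hΦc : ∀ k ω, Φ k ω ≤ c := fun k ω => by
    simp only [hΦ]; split_ifs with h
    · exact le_rfl
    · exact (hlt k ω h).le
  have hΦi : ∀ k ≤ n, Integrable (Φ k) μ := fun k hk =>
    .of_bound (hΦm k hk).aestronglyMeasurable c <| .of_forall fun ω => by
      rw [Real.norm_eq_abs, abs_of_nonneg (hΦ0 k ω)]; exact hΦc k ω
  have hmain : ∀ k ≤ n, ∫ ω, Φ k ω ∂μ ≤ 1 := by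
    intro k
    induction k with
    | zero =>
      intro _
      have : ∀ ω, Φ 0 ω ≤ 1 := fun ω => by
        simp only [hΦ]; split_ifs with h
        · obtain ⟨m, hm, h⟩ := h
          obtain rfl : m = 0 := by omega
          exact h.trans (hN0 ω)
        · exact hN0 ω
      calc ∫ ω, Φ 0 ω ∂μ ≤ ∫ _, (1 : ℝ) ∂μ :=
            integral_mono (hΦi 0 (Nat.zero_le _)) (integrable_const _) this
        _ = 1 := by simp
    | succ k ih =>
      intro hk
      have hkn : k < n := hk
      set G : Ω → ℝ := fun ω => if ω ∈ A k then 0 else g k ω with hG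
      have hGm : Measurable[ℱ k] G := Measurable.ite (hAm k hkn.le) measurable_const (hg k hkn)
      have hGc : ∀ ω, |G ω| ≤ c := fun ω => by
        simp only [hG]; split_ifs with h
        · simp; linarith
        · exact (hgN k hkn ω).trans (hlt k ω h).le
      have hei : Integrable (e k) μ := .of_bound (he k hkn).aestronglyMeasurable 1
        (.of_forall fun ω => he1 k hkn ω)
      have hGe : Integrable (fun ω => G ω * e k ω) μ :=
        hei.bdd_mul (c := c) (hGm.mono (ℱ.le k) le_rfl).aestronglyMeasurable (.of_forall hGc)
      have h0 := integral_mul_eq_zero_of_condExp (ℱ.le k) hGm hGc hei (he0 k hkn)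
      calc ∫ ω, Φ (k + 1) ω ∂μ ≤ ∫ ω, (Φ k ω + G ω * e k ω) ∂μ := by
            refine integral_mono (hΦi _ hk) ((hΦi k hkn.le).add hGe) fun ω => ?_
            by_cases h : ω ∈ A k
            · have : Φ k ω = c := by simp [hΦ, h]
              simp only [hG, h, if_true, this]
              linarith [hΦc (k + 1) ω]
            · have h1 : Φ k ω = N k ω := by simp [hΦ, h]
              have h2 : Φ (k + 1) ω ≤ N (k + 1) ω := by
                simp only [hΦ]; split_ifs with h'
                · obtain ⟨m, hm, h'⟩ := h'
                  rcases Nat.lt_or_ge m (k + 1) with h3 | h3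
                  · exact absurd ⟨m, by omega, h'⟩ h
                  · obtain rfl : m = k + 1 := by omega
                    exact h'
                · exact le_rfl
              have := hstep k hkn ω
              simp only [hG, h, if_false, h1]
              linarith
        _ ≤ 1 := by
            rw [integral_add (hΦi k hkn.le) hGe, h0, add_zero]
            exact ih hkn.le
  calc c * μ.real (A n) = ∫ ω, (A n).indicator (fun _ => c) ω ∂μ := by
        rw [integral_indicator_const _ (ℱ.le n _ (hAm n le_rfl)), smul_eq_mul, mul_comm]
    _ ≤ ∫ ω, Φ n ω ∂μ := by
        refine integral_mono ((integrable_const c).indicator (ℱ.le n _ (hAm n le_rfl)))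
          (hΦi n le_rfl) fun ω => ?_
        by_cases h : ω ∈ A n
        · simp [hΦ, h]
        · simp [h, hΦ0]
    _ ≤ 1 := hmain n le_rfl

end Ville

/-! ### Measurability of determinants and of the self-normalized process. -/

section Measurability

variable {Ω : Type*} {m : MeasurableSpace Ω} {d : ℕ}

lemma measurable_det {W : Ω → Matrix (Fin d) (Fin d) ℝ}
    (hW : ∀ a b, Measurable fun ω => W ω a b) : Measurable fun ω => (W ω).det := by
  simp only [det_apply]
  exact Finset.measurable_fun_sum _ fun σ _ =>
    (Finset.measurable_fun_prod _ fun i _ => hW _ _).const_smul _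

lemma measurable_add_vecMulVec {W : Ω → Matrix (Fin d) (Fin d) ℝ} {S : Ω → Vec d}
    (hW : ∀ a b, Measurable fun ω => W ω a b) (hS : Measurable S) (a b : Fin d) :
    Measurable fun ω => (W ω + vecMulVec (S ω) (S ω)) a b := by
  simp only [Matrix.add_apply, vecMulVec_apply]
  exact (hW a b).add (((measurable_pi_apply a).comp hS).mul ((measurable_pi_apply b).comp hS))

lemma measurable_selfNorm {W : Ω → Matrix (Fin d) (Fin d) ℝ} {S : Ω → Vec d}
    (hP : ∀ ω, (W ω).PosDef) (hW : ∀ a b, Measurable fun ω => W ω a b) (hS : Measurable S) :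
    Measurable fun ω => selfNorm (W ω) (S ω) := by
  -- As a ratio of determinants, the form is visibly measurable without treating the matrix inverse.
  have h : ∀ ω, invQuad (W ω) (S ω) = (W ω + vecMulVec (S ω) (S ω)).det / (W ω).det - 1 :=
    fun ω => by
      rw [det_add_vecMulVec (hP ω), mul_div_cancel_left₀ _ (hP ω).det_pos.ne']; ring
  simp only [selfNorm, h]
  have h1 := measurable_det hW
  have h2 := measurable_det (measurable_add_vecMulVec hW hS)
  fun_prop

lemma measurable_gram_apply {ι : Type*} {u : ι → Ω → Vec d} {s : Finset ι}
    (hu : ∀ k ∈ s, Measurable (u k)) (a b : Fin d) :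
    Measurable fun ω => gram (fun k => u k ω) s a b := by
  simp only [gram, Matrix.add_apply, Matrix.sum_apply, vecMulVec_apply]
  exact measurable_const.add <| Finset.measurable_fun_sum _ fun k hk =>
    ((measurable_pi_apply a).comp (hu k hk)).mul ((measurable_pi_apply b).comp (hu k hk))

end Measurability

/-! ### The maximal inequality for predictable samples. -/

section Samples

variable {Ω : Type*} {mΩ : MeasurableSpace Ω} {μ : Measure Ω} [IsProbabilityMeasure μ] {d : ℕ}

/-- The self-normalized maximal inequality for predictable samples `z` with bounded centered
noise `e`. -/
theorem mul_measureReal_exists_selfNorm_le {ℱ : Filtration ℕ mΩ} {n : ℕ} {e : ℕ → Ω → ℝ}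
    {z : ℕ → Ω → Vec d} {c : ℝ} (hc : 1 ≤ c) (hz : ∀ k < n, Measurable[ℱ k] (z k))
    (he : ∀ k < n, Measurable[ℱ (k + 1)] (e k)) (he1 : ∀ k < n, ∀ ω, e k ω ∈ Set.Icc (-1 : ℝ) 1)
    (he0 : ∀ k < n, μ[e k | ℱ k] =ᵐ[μ] 0) :
    c * μ.real {ω | ∃ k ≤ n, c ≤ selfNorm (gram (fun l => z l ω) (range k))
      (∑ l ∈ range k, e l ω • z l ω)} ≤ 1 := by
  have hS : ∀ k ≤ n, Measurable[ℱ k] fun ω => ∑ l ∈ range k, e l ω • z l ω := fun k hk => by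
    refine Finset.measurable_fun_sum _ fun l hl => ?_
    have hl' : l < k := mem_range.1 hl
    exact ((he l (by omega)).mono (ℱ.mono hl') le_rfl).smul
      ((hz l (by omega)).mono (ℱ.mono hl'.le) le_rfl)
  have hV : ∀ k ≤ n, ∀ a b, Measurable[ℱ k] fun ω => gram (fun l => z l ω) (range k) a b :=
    fun k hk a b => measurable_gram_apply (fun l hl => by
      have hl' : l < k := mem_range.1 hl
      exact (hz l (by omega)).mono (ℱ.mono hl'.le) le_rfl) a b
  refine mul_measureReal_exists_le (ℱ := ℱ) (e := e)
    (g := fun k ω => selfNormSlope (gram (fun l => z l ω) (range k))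
      (∑ l ∈ range k, e l ω • z l ω) (z k ω)) ?_ hc ?_ ?_ ?_ ?_ ?_ he0 ?_ ?_
  · intro ω
    simp [selfNorm, invQuad, gram_empty]
  · exact fun k hk => measurable_selfNorm (fun ω => posDef_gram _ _) (hV k hk) (hS k hk)
  · exact fun k ω => selfNorm_nonneg _ _
  · intro k hk
    have h1 := measurable_add_vecMulVec (hV k hk.le) (hz k hk)
    have hP : ∀ ω, (gram (fun l => z l ω) (range k) + vecMulVec (z k ω) (z k ω)).PosDef :=
      fun ω => (posDef_gram _ _).add_vecMulVec _
    exact ((measurable_selfNorm hP h1 ((hS k hk.le).add (hz k hk))).sub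
      (measurable_selfNorm hP h1 ((hS k hk.le).sub (hz k hk)))).div_const _
  · exact fun k hk => (he k hk).mono (ℱ.le _) le_rfl
  · exact fun k hk ω => abs_le.2 (he1 k hk ω)
  · exact fun k hk ω => abs_selfNormSlope_le (posDef_gram _ _) _ _
  · intro k hk ω
    rw [range_add_one, gram_insert _ notMem_range_self, sum_insert notMem_range_self,
      add_comm (_ • _)]
    exact selfNorm_add_le (posDef_gram _ _) _ _ (he1 k hk ω)

end Samples

/-! ### Listing the samples of all agents as one sequence. -/

section Flatten

variable {M : ℕ} [NeZero M] {α : Type*}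

/-- The samples `(0, 0), ..., (0, M - 1), (1, 0), ...` as one sequence. -/
def flat (f : ℕ → Fin M → α) (k : ℕ) : α := f (k / M) (Fin.ofNat M k)

lemma mul_add_div_self (n : ℕ) (i : Fin M) : (n * M + i) / M = n := by
  rw [mul_comm, Nat.mul_add_div (NeZero.pos M), Nat.div_eq_of_lt i.isLt, add_zero]

lemma ofNat_mul_add (n : ℕ) (i : Fin M) : Fin.ofNat M (n * M + i) = i := by
  ext
  simp [Fin.ofNat, Nat.mod_eq_of_lt i.isLt]

lemma flat_mul_add (f : ℕ → Fin M → α) (n : ℕ) (i : Fin M) : flat f (n * M + i) = f n i := by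
  rw [flat, mul_add_div_self, ofNat_mul_add]

lemma sum_range_mul [AddCommMonoid α] (f : ℕ → Fin M → α) (n : ℕ) :
    ∑ k ∈ range (n * M), flat f k = ∑ m ∈ range n, ∑ j, f m j := by
  induction n with
  | zero => simp
  | succ n ih =>
    rw [add_mul, one_mul, sum_range_add, ih, sum_range_succ,
      sum_range fun x => flat f (n * M + x)]
    simp only [flat_mul_add]

end Flatten

/-! ### Closed forms for the synchronized and local sums. -/

section Accumulate

variable {M : ℕ} {α : Type*} [AddCommMonoid α]

open Classical in
/-- The number of indices below `n` at which `p` holds. -/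
noncomputable def countBelow (p : ℕ → Prop) (n : ℕ) : ℕ := #{m ∈ range n | p m}

lemma countBelow_zero (p : ℕ → Prop) : countBelow p 0 = 0 := by simp [countBelow]

lemma countBelow_succ_of_pos {p : ℕ → Prop} {n : ℕ} (h : p n) :
    countBelow p (n + 1) = countBelow p n + 1 := by
  classical
  rw [countBelow, range_add_one, filter_insert, if_pos h,
    card_insert_of_notMem (by simp), countBelow]

lemma countBelow_succ_of_neg {p : ℕ → Prop} {n : ℕ} (h : ¬ p n) :
    countBelow p (n + 1) = countBelow p n := by
  classical
  rw [countBelow, range_add_one, filter_insert, if_neg h, countBelow]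

lemma countBelow_mono (p : ℕ → Prop) : Monotone (countBelow p) := fun m n h => by
  classical
  exact card_le_card (filter_subset_filter _ (range_mono h))

/-- Two registers, a common one that absorbs the individual ones whenever `p` holds. -/
lemma registers_eq {p : ℕ → Prop} {f : ℕ → Fin M → α} {X : ℕ → α} {Y : ℕ → Fin M → α}
    (hX0 : X 0 = 0) (hY0 : ∀ i, Y 0 i = 0)
    (hXp : ∀ n, p n → X (n + 1) = X n + ∑ j, (Y n j + f n j))
    (hYp : ∀ n, p n → ∀ i, Y (n + 1) i = 0)
    (hXn : ∀ n, ¬ p n → X (n + 1) = X n) (hYn : ∀ n, ¬ p n → ∀ i, Y (n + 1) i = Y n i + f n i)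
    (n : ℕ) :
    X n = ∑ m ∈ range n, ∑ j, (if countBelow p m < countBelow p n then f m j else 0) ∧
    ∀ i, Y n i = ∑ m ∈ range n, if countBelow p m = countBelow p n then f m i else 0 := by
  induction n with
  | zero => simp [hX0, hY0]
  | succ n ih =>
    obtain ⟨ihX, ihY⟩ := ih
    by_cases h : p n
    · have hlt : ∀ m ∈ range (n + 1), countBelow p m < countBelow p n + 1 := fun m hm =>
        Nat.lt_succ_of_le (countBelow_mono p (Nat.lt_succ_iff.1 (mem_range.1 hm)))
      refine ⟨?_, fun i => ?_⟩
      · have hall : ∑ m ∈ range (n + 1), ∑ j,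
            (if countBelow p m < countBelow p n + 1 then f m j else 0) =
            ∑ m ∈ range (n + 1), ∑ j, f m j :=
          sum_congr rfl fun m hm => sum_congr rfl fun j _ => if_pos (hlt m hm)
        rw [hXp n h, countBelow_succ_of_pos h, hall, sum_add_distrib, ← add_assoc, ihX,
          sum_range_succ, sum_congr rfl fun j _ => ihY j, sum_comm (s := univ), ← sum_add_distrib]
        congr 1
        refine sum_congr rfl fun m hm => ?_
        rw [← sum_add_distrib]
        refine sum_congr rfl fun j _ => ?_
        rcases (countBelow_mono p (mem_range.1 hm).le).lt_or_eq with h' | h'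
        · simp [h', h'.ne]
        · simp [h']
      · rw [hYp n h, countBelow_succ_of_pos h, sum_eq_zero]
        exact fun m hm => if_neg (hlt m hm).ne
    · refine ⟨?_, fun i => ?_⟩
      · rw [hXn n h, countBelow_succ_of_neg h, sum_range_succ]
        simpa using ihX
      · rw [hYn n h, countBelow_succ_of_neg h, sum_range_succ, ihY]
        simp

lemma registers_add_eq {p : ℕ → Prop} {f : ℕ → Fin M → α} (n : ℕ) (i : Fin M) :
    (∑ m ∈ range n, ∑ j, (if countBelow p m < countBelow p n then f m j else 0)) +
      (∑ m ∈ range n, if countBelow p m = countBelow p n then f m i else 0) =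
    ∑ m ∈ range n, ∑ j, if countBelow p m < countBelow p n ∨ j = i then f m j else 0 := by
  rw [← sum_add_distrib]
  refine sum_congr rfl fun m hm => ?_
  rcases (countBelow_mono p (mem_range.1 hm).le).lt_or_eq with h' | h'
  · simp [h', h'.ne]
  · simp [h']

end Accumulate

/-! ### Epochs, gains and the number of rounds along one trajectory. -/

section Trajectory

variable {M d : ℕ} (D : ℝ) (a : ℕ → Fin M → Vec d) (r : ℕ → Fin M → ℝ)

/-- The state after recording the samples with index `n`. -/
noncomputable def recorded (n : ℕ) : State M d := (stateAfter D a r n).record (a n) (r n)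

/-- A communication round takes place after recording the samples with index `n`. -/
def Syncs (n : ℕ) : Prop := ∃ i, (recorded D a r n).Signals D (n + 1) i

/-- The number of communication rounds before the samples with index `n`. -/
noncomputable def rounds (n : ℕ) : ℕ := countBelow (Syncs D a r) n

variable {D a r}

lemma stateAfter_succ_of_pos {n : ℕ} (h : Syncs D a r n) :
    stateAfter D a r (n + 1) = (recorded D a r n).sync (n + 1) := if_pos h

lemma stateAfter_succ_of_neg {n : ℕ} (h : ¬ Syncs D a r n) :
    stateAfter D a r (n + 1) = recorded D a r n := if_neg h

lemma rounds_mono : Monotone (rounds D a r) := countBelow_mono _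

lemma rounds_zero : rounds D a r 0 = 0 := countBelow_zero _

lemma rounds_succ_of_pos {n : ℕ} (h : Syncs D a r n) :
    rounds D a r (n + 1) = rounds D a r n + 1 := countBelow_succ_of_pos h

lemma rounds_succ_of_neg {n : ℕ} (h : ¬ Syncs D a r n) :
    rounds D a r (n + 1) = rounds D a r n := countBelow_succ_of_neg h

lemma Wsyn_Wnew_eq (n : ℕ) :
    (stateAfter D a r n).Wsyn = ∑ m ∈ range n, ∑ j,
      (if rounds D a r m < rounds D a r n then vecMulVec (a m j) (a m j) else 0) ∧
    ∀ i, (stateAfter D a r n).Wnew i = ∑ m ∈ range n,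
      if rounds D a r m = rounds D a r n then vecMulVec (a m i) (a m i) else 0 := by
  refine registers_eq (p := Syncs D a r) (f := fun m j => vecMulVec (a m j) (a m j))
    (X := fun n => (stateAfter D a r n).Wsyn) (Y := fun n => (stateAfter D a r n).Wnew)
    rfl (fun _ => rfl) ?_ ?_ ?_ ?_ n <;> intro n h
  · rw [stateAfter_succ_of_pos h]; rfl
  · rw [stateAfter_succ_of_pos h]; exact fun _ => rfl
  · rw [stateAfter_succ_of_neg h]; rfl
  · rw [stateAfter_succ_of_neg h]; exact fun _ => rfl

lemma Usyn_Unew_eq (n : ℕ) :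
    (stateAfter D a r n).Usyn = ∑ m ∈ range n, ∑ j,
      (if rounds D a r m < rounds D a r n then r m j • a m j else 0) ∧
    ∀ i, (stateAfter D a r n).Unew i = ∑ m ∈ range n,
      if rounds D a r m = rounds D a r n then r m i • a m i else 0 := by
  refine registers_eq (p := Syncs D a r) (f := fun m j => r m j • a m j)
    (X := fun n => (stateAfter D a r n).Usyn) (Y := fun n => (stateAfter D a r n).Unew)
    rfl (fun _ => rfl) ?_ ?_ ?_ ?_ n <;> intro n h
  · rw [stateAfter_succ_of_pos h]; rfl
  · rw [stateAfter_succ_of_pos h]; exact fun _ => rfl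
  · rw [stateAfter_succ_of_neg h]; rfl
  · rw [stateAfter_succ_of_neg h]; exact fun _ => rfl

lemma recorded_V (n : ℕ) (i : Fin M) :
    (recorded D a r n).V i = (stateAfter D a r n).V i + vecMulVec (a n i) (a n i) :=
  (add_assoc _ _ _).symm

variable (D a r) in
/-- The increment of the log-determinant that agent `i` has collected since the last round. -/
noncomputable def gain (n : ℕ) (i : Fin M) : ℝ :=
  Real.log ((stateAfter D a r n).V i).det - Real.log (stateAfter D a r n).Vlast.det

lemma gain_succ_of_pos {n : ℕ} (h : Syncs D a r n) (i : Fin M) : gain D a r (n + 1) i = 0 := by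
  rw [gain, stateAfter_succ_of_pos h, sub_eq_zero]
  congr 2
  exact add_zero _

lemma tlast_le (n : ℕ) : (stateAfter D a r n).tlast ≤ n := by
  induction n with
  | zero => rfl
  | succ n ih =>
    by_cases h : Syncs D a r n
    · rw [stateAfter_succ_of_pos h]; rfl
    · rw [stateAfter_succ_of_neg h]; exact ih.trans n.le_succ

lemma gain_zero (i : Fin M) : gain D a r 0 i = 0 := by
  simp [gain, stateAfter, State.V, State.Vlast, State.start]

/-- The number of samples of an agent since the last round. -/
lemma card_epoch (n : ℕ) :
    (#{m ∈ range n | rounds D a r m = rounds D a r n} : ℝ) = n - (stateAfter D a r n).tlast := by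
  induction n with
  | zero => simp [stateAfter, State.start]
  | succ n ih =>
    by_cases h : Syncs D a r n
    · rw [filter_false_of_mem, stateAfter_succ_of_pos h]
      · simp [State.sync]
      · intro m hm
        rw [rounds_succ_of_pos h]
        exact (Nat.lt_succ_of_le (rounds_mono (Nat.lt_succ_iff.1 (mem_range.1 hm)))).ne
    · rw [stateAfter_succ_of_neg h, rounds_succ_of_neg h, range_add_one, filter_insert,
        if_pos rfl, card_insert_of_notMem (by simp), Nat.cast_add, ih]
      simp [recorded, State.record]
      ring

lemma commCost_le (T : ℕ) :
    commCost D T a r ≤ rounds D a r T * (2 * M + 2 * (M * (d ^ 2 + d))) := by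
  classical
  induction T with
  | zero => simp [commCost]
  | succ n ih =>
    have hs : commCost D (n + 1) a r =
        commCost D n a r + (recorded D a r n).commCost D (n + 1) := sum_range_succ _ _
    rw [hs]
    by_cases h : Syncs D a r n
    · rw [rounds_succ_of_pos h, State.commCost,
        if_pos (show ∃ i, (recorded D a r n).Signals D (n + 1) i from h), add_mul, one_mul]
      have := card_filter_le (univ : Finset (Fin M))
        (fun i => (recorded D a r n).Signals D (n + 1) i)
      rw [card_univ, Fintype.card_fin] at this
      omega
    · rw [rounds_succ_of_neg h, State.commCost,
        if_neg (show ¬ ∃ i, (recorded D a r n).Signals D (n + 1) i from h)]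
      exact ih

variable [NeZero M]

variable (D a r) in
/-- The samples up to index `n` that were collected before round `p` or by agent `i`. -/
noncomputable def known (p : ℕ) (i : Fin M) (n : ℕ) : Finset ℕ :=
  {k ∈ range (n * M) | rounds D a r (k / M) < p ∨ Fin.ofNat M k = i}

variable (D a r) in
/-- The samples up to index `n` that were collected before round `p`. -/
noncomputable def synced (p n : ℕ) : Finset ℕ :=
  {k ∈ range (n * M) | rounds D a r (k / M) < p}

lemma V_eq_gram (n : ℕ) (i : Fin M) :
    (stateAfter D a r n).V i = gram (flat a) (known D a r (rounds D a r n) i n) := by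
  rw [State.V, (Wsyn_Wnew_eq n).1, (Wsyn_Wnew_eq n).2 i, add_assoc]
  unfold rounds
  rw [registers_add_eq, ← sum_range_mul, gram, known, sum_filter]
  rfl

lemma Vlast_eq_gram (n : ℕ) :
    (stateAfter D a r n).Vlast = gram (flat a) (synced D a r (rounds D a r n) n) := by
  rw [State.Vlast, (Wsyn_Wnew_eq n).1, ← sum_range_mul, gram, synced, sum_filter]
  rfl

lemma Usyn_add_Unew (n : ℕ) (i : Fin M) :
    (stateAfter D a r n).Usyn + (stateAfter D a r n).Unew i =
      ∑ k ∈ known D a r (rounds D a r n) i n, flat r k • flat a k := by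
  rw [(Usyn_Unew_eq n).1, (Usyn_Unew_eq n).2 i]
  unfold rounds
  rw [registers_add_eq, ← sum_range_mul, known, sum_filter]
  rfl

lemma lt_of_rounds_lt {k n : ℕ} (h : rounds D a r (k / M) < rounds D a r n) : k < n * M := by
  rw [← Nat.div_lt_iff_lt_mul (NeZero.pos M)]
  exact rounds_mono.reflect_lt h

/-- Samples from before the latest round lie in the past already, so the horizon may be moved to
`T`. This lets the potential be indexed by the round number alone. -/
lemma synced_eq_of_le {n T : ℕ} (h : n ≤ T) :
    synced D a r (rounds D a r n) n = synced D a r (rounds D a r n) T := by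
  ext k
  simp only [synced, mem_filter, mem_range]
  exact ⟨fun hk => ⟨hk.1.trans_le (Nat.mul_le_mul_right _ h), hk.2⟩,
    fun hk => ⟨lt_of_rounds_lt hk.2, hk.2⟩⟩

lemma synced_subset_known (p : ℕ) (i : Fin M) (n : ℕ) : synced D a r p n ⊆ known D a r p i n :=
  monotone_filter_right _ fun _ _ h => Or.inl h

lemma posDef_V (n : ℕ) (i : Fin M) : ((stateAfter D a r n).V i).PosDef := by
  rw [V_eq_gram]; exact posDef_gram _ _

variable (D a r) in
/-- The squared width `xᵀ V⁻¹ x` of the action of agent `i` at index `n`. -/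
noncomputable def width (n : ℕ) (i : Fin M) : ℝ := invQuad ((stateAfter D a r n).V i) (a n i)

lemma width_nonneg (n : ℕ) (i : Fin M) : 0 ≤ width D a r n i := invQuad_nonneg (posDef_V n i) _

lemma recorded_V_eq_gram (n : ℕ) (i : Fin M) :
    (recorded D a r n).V i =
      gram (flat a) (insert (n * M + i) (known D a r (rounds D a r n) i n)) := by
  rw [recorded_V, V_eq_gram, gram_insert, flat_mul_add]
  simp [known]

lemma log_det_recorded_V (n : ℕ) (i : Fin M) :
    Real.log ((recorded D a r n).V i).det =
      Real.log ((stateAfter D a r n).V i).det + Real.log (1 + width D a r n i) := by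
  have h := width_nonneg (D := D) (a := a) (r := r) n i
  rw [recorded_V, det_add_vecMulVec (posDef_V n i), Real.log_mul (posDef_V n i).det_pos.ne']
  · rfl
  · exact (show 0 < 1 + width D a r n i by positivity).ne'

lemma synced_succ_of_pos {n : ℕ} (h : Syncs D a r n) :
    synced D a r (rounds D a r (n + 1)) (n + 1) = range ((n + 1) * M) := by
  refine filter_true_of_mem fun k hk => ?_
  rw [mem_range, ← Nat.div_lt_iff_lt_mul (NeZero.pos M)] at hk
  rw [rounds_succ_of_pos h]
  exact Nat.lt_succ_of_le (rounds_mono (Nat.lt_succ_iff.1 hk))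

lemma insert_known_subset (p n : ℕ) (i : Fin M) :
    insert (n * M + (i : ℕ)) (known D a r p i n) ⊆ range ((n + 1) * M) := by
  have := i.isLt
  intro k hk
  simp only [mem_insert, known, mem_filter, mem_range] at hk ⊢
  rw [add_mul, one_mul]
  rcases hk with rfl | hk <;> omega

lemma det_Vlast_pos (n : ℕ) : 0 < (stateAfter D a r n).Vlast.det := by
  rw [Vlast_eq_gram]; exact (posDef_gram _ _).det_pos

lemma gain_nonneg (n : ℕ) (i : Fin M) : 0 ≤ gain D a r n i := by
  rw [gain, sub_nonneg]
  refine Real.log_le_log (det_Vlast_pos n) ?_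
  rw [V_eq_gram, Vlast_eq_gram]
  exact det_gram_mono _ (synced_subset_known _ _ _)

lemma signals_recorded_iff (n : ℕ) (i : Fin M) :
    (recorded D a r n).Signals D (n + 1) i ↔
      D < (gain D a r n i + Real.log (1 + width D a r n i)) *
        ((n : ℝ) + 1 - (stateAfter D a r n).tlast) := by
  have h1 : (recorded D a r n).Vlast = (stateAfter D a r n).Vlast := rfl
  have h2 : ((recorded D a r n).V i).det ≠ 0 := by
    rw [recorded_V_eq_gram]; exact (posDef_gram _ _).det_pos.ne'
  rw [State.Signals, Real.log_div h2 (h1 ▸ (det_Vlast_pos n).ne'), log_det_recorded_V, h1, gain]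
  have h3 : (recorded D a r n).tlast = (stateAfter D a r n).tlast := rfl
  rw [h3, add_sub_right_comm]
  push_cast
  rfl

lemma gain_succ_of_neg {n : ℕ} (h : ¬ Syncs D a r n) (i : Fin M) :
    gain D a r (n + 1) i = gain D a r n i + Real.log (1 + width D a r n i) := by
  rw [gain, stateAfter_succ_of_neg h, log_det_recorded_V, gain, add_sub_right_comm]
  rfl

/-- Immediately after a round the gain is zero; otherwise nobody signalled at the previous step,
which is this inequality. -/
lemma gain_mul_le (hD : 0 ≤ D) (n : ℕ) (i : Fin M) :
    gain D a r n i * (n - (stateAfter D a r n).tlast) ≤ D := by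
  cases n with
  | zero => simpa [gain_zero]
  | succ n =>
    by_cases h : Syncs D a r n
    · simpa [gain_succ_of_pos h]
    · rw [gain_succ_of_neg h, stateAfter_succ_of_neg h]
      have h' : ¬ (recorded D a r n).Signals D (n + 1) i := fun h' => h ⟨i, h'⟩
      rw [signals_recorded_iff, not_lt] at h'
      push_cast
      exact h'

/-- Within an epoch an agent's matrix changes only through its own samples, so the elliptical
potential argument applies to each agent separately. -/
lemma sum_min_width_epoch_le (n : ℕ) (i : Fin M) :
    ∑ m ∈ range n with rounds D a r m = rounds D a r n, min 1 (width D a r m i) ≤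
      2 * gain D a r n i := by
  induction n with
  | zero => simp [gain_zero]
  | succ n ih =>
    by_cases h : Syncs D a r n
    · rw [filter_false_of_mem, gain_succ_of_pos h]
      · simp
      · intro m hm
        rw [rounds_succ_of_pos h]
        exact (Nat.lt_succ_of_le (rounds_mono (Nat.lt_succ_iff.1 (mem_range.1 hm)))).ne
    · rw [gain_succ_of_neg h, rounds_succ_of_neg h, range_add_one, filter_insert,
        if_pos rfl, sum_insert (by simp)]
      have := min_one_le_two_mul_log (width_nonneg (D := D) (a := a) (r := r) n i)
      linarith

lemma sum_sqrt_le {ι : Type*} (s : Finset ι) {q : ι → ℝ} (hq : ∀ k ∈ s, 0 ≤ q k) :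
    ∑ k ∈ s, √(q k) ≤ √(#s * ∑ k ∈ s, q k) := by
  refine Real.le_sqrt_of_sq_le ?_
  refine (sq_sum_le_card_mul_sum_sq).trans_eq ?_
  rw [sum_congr rfl fun k hk => Real.sq_sqrt (hq k hk)]

lemma sum_sqrt_width_epoch_le (hD : 0 ≤ D) (n : ℕ) (i : Fin M) :
    ∑ m ∈ range n with rounds D a r m = rounds D a r n, √(min 1 (width D a r m i)) ≤
      √(2 * D) := by
  refine (sum_sqrt_le _ fun m _ => le_min zero_le_one (width_nonneg m i)).trans
    (Real.sqrt_le_sqrt ?_)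
  rw [card_epoch]
  have h1 : (0 : ℝ) ≤ n - (stateAfter D a r n).tlast :=
    sub_nonneg.2 (by exact_mod_cast tlast_le n)
  have h2 := sum_min_width_epoch_le (D := D) (a := a) (r := r) n i
  have h3 := gain_mul_le (a := a) (r := r) hD n i
  nlinarith [mul_le_mul_of_nonneg_left h2 h1]

/-- The total of the regret terms of one agent in one epoch. -/
lemma sum_epoch_le (hD : 0 ≤ D) {B : ℝ} (hB : 0 ≤ B) {T : ℕ} {i : Fin M} {ρ : ℕ → ℝ}
    (h2 : ∀ n < T, ρ n ≤ 2) (hw : ∀ n < T, ρ n ≤ B * √(min 1 (width D a r n i))) (p : ℕ) :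
    ∑ n ∈ range T with rounds D a r n = p, ρ n ≤ B * √(2 * D) + 2 := by
  rcases Finset.eq_empty_or_nonempty {n ∈ range T | rounds D a r n = p} with h | h
  · rw [h, sum_empty]; positivity
  -- The sample of the last step `n` of the epoch may be the one that breaks the threshold, so it is
  -- charged the trivial bound 2; the earlier ones obey the trigger inequality at `n`.
  · obtain ⟨n, hnF, hle⟩ : ∃ n ∈ ({n ∈ range T | rounds D a r n = p} : Finset ℕ),
        ∀ m ∈ ({n ∈ range T | rounds D a r n = p} : Finset ℕ), m ≤ n :=
      ⟨_, max'_mem _ h, fun m hm => le_max' _ m hm⟩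
    obtain ⟨hn, hnp⟩ := mem_filter.1 hnF
    rw [mem_range] at hn
    have : {m ∈ range T | rounds D a r m = p} =
        insert n {m ∈ range n | rounds D a r m = rounds D a r n} := by
      ext m
      have := hle m
      simp only [mem_filter, mem_range, mem_insert, hnp] at this ⊢
      constructor
      · intro hm
        have := this hm
        rcases this.eq_or_lt with h | h
        · exact Or.inl h
        · exact Or.inr ⟨h, hm.2⟩
      · rintro (rfl | hm)
        · exact ⟨hn, hnp⟩
        · exact ⟨hm.1.trans hn, hm.2⟩
    rw [this, sum_insert (by simp), add_comm]
    refine add_le_add ?_ (h2 n hn)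
    calc _ ≤ ∑ m ∈ range n with rounds D a r m = rounds D a r n,
          B * √(min 1 (width D a r m i)) :=
          sum_le_sum fun m hm => hw m ((mem_range.1 (mem_filter.1 hm).1).trans hn)
      _ ≤ _ := by
        rw [← mul_sum]
        exact mul_le_mul_of_nonneg_left (sum_sqrt_width_epoch_le hD n i) hB

lemma two_mul_sqrt_le {c t l : ℝ} (hc : 0 < c) (ht : 0 ≤ t) (hl : 0 ≤ l) (hD : D ≤ l * t) :
    2 * √D ≤ c * t + l / c := by
  have h : √D ≤ √(c * t) * √(l / c) := by
    rw [← Real.sqrt_mul (by positivity)]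
    refine Real.sqrt_le_sqrt (hD.trans_eq ?_)
    field_simp
  have h1 := Real.sq_sqrt (show 0 ≤ c * t by positivity)
  have h2 := Real.sq_sqrt (show 0 ≤ l / c by positivity)
  nlinarith [sq_nonneg (√(c * t) - √(l / c))]

/-- By AM–GM each round raises the right-hand side by at least `2√D`. The free parameter `c` weighs
elapsed time against log-determinant. -/
lemma rounds_mul_le {c : ℝ} (hc : 0 < c) (n : ℕ) :
    rounds D a r n * (2 * √D) ≤ c * (stateAfter D a r n).tlast +
      Real.log (stateAfter D a r n).Vlast.det / c := by
  induction n with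
  | zero => simp [rounds_zero, stateAfter, State.start, State.Vlast]
  | succ n ih =>
    by_cases h : Syncs D a r n
    · obtain ⟨i, hi⟩ := id h
      rw [signals_recorded_iff] at hi
      -- The round pools all samples, so the new common determinant dominates that of the signalling
      -- agent and its gain is not lost.
      have h1 : Real.log ((recorded D a r n).V i).det ≤
          Real.log (stateAfter D a r (n + 1)).Vlast.det := by
        rw [recorded_V_eq_gram, Vlast_eq_gram, synced_succ_of_pos h]
        exact Real.log_le_log (posDef_gram _ _).det_pos
          (det_gram_mono _ (insert_known_subset _ _ _))
      rw [log_det_recorded_V] at h1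
      have h2 : ((stateAfter D a r n).tlast : ℝ) ≤ n := by exact_mod_cast tlast_le n
      have h3 := gain_nonneg (D := D) (a := a) (r := r) n i
      have h4 : 0 ≤ Real.log (1 + width D a r n i) :=
        Real.log_nonneg (by linarith [width_nonneg (D := D) (a := a) (r := r) n i])
      have h5 := two_mul_sqrt_le hc (by linarith) (by linarith) hi.le
      have h6 : (stateAfter D a r (n + 1)).tlast = n + 1 := by
        rw [stateAfter_succ_of_pos h]; rfl
      rw [rounds_succ_of_pos h, h6]
      have h7 : (gain D a r n i + Real.log (1 + width D a r n i)) / c ≤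
          Real.log (stateAfter D a r (n + 1)).Vlast.det / c -
            Real.log (stateAfter D a r n).Vlast.det / c := by
        rw [← sub_div, gain]
        gcongr
        linarith
      push_cast
      linarith
    · rw [rounds_succ_of_neg h, stateAfter_succ_of_neg h]
      exact ih

lemma log_det_Vlast_le {n T : ℕ} (h : n ≤ T) :
    Real.log (stateAfter D a r n).Vlast.det ≤ Real.log (gram (flat a) (range (T * M))).det := by
  rw [Vlast_eq_gram, synced_eq_of_le h]
  exact Real.log_le_log (posDef_gram _ _).det_pos (det_gram_mono _ (filter_subset _ _))

end Trajectory

/-! ### The elliptical potential identity. -/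

section EllipticalPotential

variable {d : ℕ}

lemma sum_log_one_add_invQuad (u : ℕ → Vec d) (n : ℕ) :
    ∑ k ∈ range n, Real.log (1 + invQuad (gram u (range k)) (u k)) =
      Real.log (gram u (range n)).det := by
  induction n with
  | zero => simp [gram_empty]
  | succ n ih =>
    have h := invQuad_nonneg (posDef_gram u (range n)) (u n)
    rw [sum_range_succ, ih, range_add_one, gram_insert _ notMem_range_self,
      det_add_vecMulVec (posDef_gram _ _), Real.log_mul (posDef_gram _ _).det_pos.ne'
      (by positivity)]

end EllipticalPotential

/-! ### Splitting epochs by their increase of the potential. -/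

section Regret

variable {M d : ℕ} [NeZero M] {D : ℝ} {a : ℕ → Fin M → Vec d} {r : ℕ → Fin M → ℝ}

variable (D a r) in
/-- The log-determinant of the samples collected before round `p`. -/
noncomputable def potential (T p : ℕ) : ℝ := Real.log (gram (flat a) (synced D a r p T)).det

lemma potential_mono (T : ℕ) : Monotone (potential D a r T) := fun _ _ h =>
  Real.log_le_log (posDef_gram _ _).det_pos <| det_gram_mono _ <|
    monotone_filter_right _ fun _ _ h' => h'.trans_le h

/-- In an epoch with a bounded increase of the potential, the width with respect to the samples
known to an agent is comparable to the width with respect to all earlier samples. -/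
lemma min_width_le_of_potential_le {n T : ℕ} (hn : n < T) (i : Fin M)
    (hg : potential D a r T (rounds D a r n + 1) - potential D a r T (rounds D a r n) ≤ 1) :
    min 1 (width D a r n i) ≤
      6 * Real.log (1 + invQuad (gram (flat a) (range (n * M + i))) (a n i)) := by
  have hiM := i.isLt
  set K := known D a r (rounds D a r n) i n
  set w := invQuad (gram (flat a) (range (n * M + i))) (a n i)
  have hw0 : 0 ≤ w := invQuad_nonneg (posDef_gram _ _) _
  have hKd := (posDef_gram (flat a) K).det_pos
  have hsub : K ⊆ range (n * M + i) :=
    (filter_subset _ _).trans (range_mono (Nat.le_add_right _ _))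
  have h1 := det_mul_invQuad_gram_mono (flat a) hsub (a n i)
  -- All samples before this one belong to the current epoch or earlier, hence are collected before
  -- round `rounds n + 1`. The potential rises by at most 1 in between, and `e < 3`.
  have h2 : (gram (flat a) (range (n * M + i))).det ≤ 3 * (gram (flat a) K).det := by
    calc (gram (flat a) (range (n * M + i))).det
        ≤ (gram (flat a) (synced D a r (rounds D a r n + 1) T)).det := by
          refine det_gram_mono _ fun k hk => ?_
          rw [mem_range] at hk
          have hk' : k < (n + 1) * M := by rw [add_mul, one_mul]; omega
          simp only [synced, mem_filter, mem_range]
          refine ⟨hk'.trans_le (Nat.mul_le_mul_right _ hn), Nat.lt_succ_of_le (rounds_mono ?_)⟩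
          exact Nat.lt_succ_iff.1 ((Nat.div_lt_iff_lt_mul (NeZero.pos M)).2 hk')
      _ = Real.exp (potential D a r T (rounds D a r n + 1)) :=
          (Real.exp_log (posDef_gram _ _).det_pos).symm
      _ ≤ Real.exp (1 + potential D a r T (rounds D a r n)) := Real.exp_le_exp.2 (by linarith)
      _ = Real.exp 1 * (gram (flat a) (synced D a r (rounds D a r n) T)).det := by
          rw [Real.exp_add, potential, Real.exp_log (posDef_gram _ _).det_pos]
      _ ≤ 3 * (gram (flat a) K).det := by
          rw [← synced_eq_of_le hn.le]
          have := det_gram_mono (flat a) (synced_subset_known (D := D) (a := a) (r := r)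
            (rounds D a r n) i n)
          have := (posDef_gram (flat a) (synced D a r (rounds D a r n) n)).det_pos
          have := Real.exp_one_lt_d9
          gcongr
          linarith
  have h3 : width D a r n i ≤ 3 * w := by
    rw [width, V_eq_gram]
    have h4 := mul_le_mul_of_nonneg_right h2 hw0
    have h5 := h1.trans h4
    rw [mul_comm 3, mul_assoc] at h5
    exact le_of_mul_le_mul_left h5 hKd
  have h4 := min_one_le_two_mul_log hw0
  have h5 : min 1 (width D a r n i) ≤ 3 * min 1 w := by
    rw [mul_min_of_nonneg _ _ (by norm_num)]
    exact min_le_min (by norm_num) h3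
  linarith

/-- The number of epochs with a large increase of the potential. -/
lemma card_large_increase_le (T P : ℕ) {R : ℝ}
    (hR : Real.log (gram (flat a) (range (T * M))).det ≤ R) :
    (#{p ∈ range P | 1 < potential D a r T (p + 1) - potential D a r T p} : ℝ) ≤ R := by
  have h0 : potential D a r T 0 = 0 := by simp [potential, synced, gram_empty]
  calc (#{p ∈ range P | 1 < potential D a r T (p + 1) - potential D a r T p} : ℝ)
      = ∑ p ∈ range P with 1 < potential D a r T (p + 1) - potential D a r T p, (1 : ℝ) := by
        simp
    _ ≤ ∑ p ∈ range P with 1 < potential D a r T (p + 1) - potential D a r T p,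
          (potential D a r T (p + 1) - potential D a r T p) :=
        sum_le_sum fun p hp => (mem_filter.1 hp).2.le
    _ ≤ ∑ p ∈ range P, (potential D a r T (p + 1) - potential D a r T p) :=
        sum_le_sum_of_subset_of_nonneg (filter_subset _ _) fun p _ _ =>
          sub_nonneg.2 (potential_mono T p.le_succ)
    _ = potential D a r T P := by rw [sum_range_sub, h0, sub_zero]
    _ ≤ Real.log (gram (flat a) (range (T * M))).det :=
        Real.log_le_log (posDef_gram _ _).det_pos (det_gram_mono _ (filter_subset _ _))
    _ ≤ R := hR

/-- The regret terms are summable against the widths: the epochs with a small increase of the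
potential contribute the first summand, the others the second. -/
theorem sum_le_of_le_width (hD : 0 ≤ D) {B R : ℝ} (hB : 0 ≤ B) {T : ℕ} {ρ : ℕ → Fin M → ℝ}
    (h2 : ∀ n < T, ∀ i, ρ n i ≤ 2)
    (hw : ∀ n < T, ∀ i, ρ n i ≤ B * √(min 1 (width D a r n i)))
    (hR : Real.log (gram (flat a) (range (T * M))).det ≤ R) :
    ∑ n ∈ range T, ∑ i, ρ n i ≤ B * √(T * M * (6 * R)) + R * (M * (B * √(2 * D) + 2)) := by
  set bad : ℕ → Prop := fun p => 1 < potential D a r T (p + 1) - potential D a r T p with hbad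
  classical
  rw [← sum_filter_add_sum_filter_not (range T) (fun n => ¬ bad (rounds D a r n))]
  simp only [not_not]
  refine add_le_add ?_ ?_
  · set G := {n ∈ range T | ¬ bad (rounds D a r n)}
    calc ∑ n ∈ G, ∑ i, ρ n i = ∑ q ∈ G ×ˢ (univ : Finset (Fin M)), ρ q.1 q.2 :=
          (sum_product' _ _ _).symm
      _ ≤ ∑ q ∈ G ×ˢ (univ : Finset (Fin M)), B * √(min 1 (width D a r q.1 q.2)) :=
          sum_le_sum fun q hq => hw _ (mem_range.1 (mem_filter.1 (mem_product.1 hq).1).1) _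
      _ = B * ∑ q ∈ G ×ˢ (univ : Finset (Fin M)), √(min 1 (width D a r q.1 q.2)) :=
          (mul_sum _ _ _).symm
      _ ≤ B * √(T * M * (6 * R)) := by
          refine mul_le_mul_of_nonneg_left ((sum_sqrt_le _ fun q _ =>
            le_min zero_le_one (width_nonneg q.1 q.2)).trans (Real.sqrt_le_sqrt ?_)) hB
          refine mul_le_mul ?_ ?_ (sum_nonneg fun q _ =>
            le_min zero_le_one (width_nonneg q.1 q.2)) (by positivity)
          · rw [card_product, card_univ, Fintype.card_fin, Nat.cast_mul]
            have : #G ≤ T := (card_filter_le _ _).trans_eq (card_range T)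
            gcongr
          · have hnn : ∀ n i, 0 ≤ 6 * Real.log
                (1 + invQuad (gram (flat a) (range (n * M + (i : Fin M)))) (a n i)) :=
              fun n i => mul_nonneg (by norm_num) (Real.log_nonneg (by
                linarith [invQuad_nonneg (posDef_gram (flat a) (range (n * M + i))) (a n i)]))
            calc ∑ q ∈ G ×ˢ (univ : Finset (Fin M)), min 1 (width D a r q.1 q.2)
                ≤ ∑ q ∈ G ×ˢ (univ : Finset (Fin M)), 6 * Real.log
                  (1 + invQuad (gram (flat a) (range (q.1 * M + q.2))) (a q.1 q.2)) := by
                  refine sum_le_sum fun q hq => ?_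
                  have hq' := mem_filter.1 (mem_product.1 hq).1
                  exact min_width_le_of_potential_le (mem_range.1 hq'.1) q.2 (not_lt.1 hq'.2)
              _ = ∑ n ∈ G, ∑ i, 6 * Real.log
                  (1 + invQuad (gram (flat a) (range (n * M + (i : Fin M)))) (a n i)) :=
                  sum_product _ _ _
              _ ≤ ∑ n ∈ range T, ∑ i, 6 * Real.log
                  (1 + invQuad (gram (flat a) (range (n * M + (i : Fin M)))) (a n i)) :=
                  sum_le_sum_of_subset_of_nonneg (filter_subset _ _) fun n _ _ =>
                    sum_nonneg fun i _ => hnn n i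
              _ = 6 * ∑ k ∈ range (T * M), Real.log
                  (1 + invQuad (gram (flat a) (range k)) (flat a k)) := by
                  rw [mul_sum, ← sum_range_mul]
                  refine sum_congr rfl fun k _ => ?_
                  simp only [flat, Fin.val_ofNat, Nat.div_add_mod']
              _ ≤ 6 * R := by rw [sum_log_one_add_invQuad]; gcongr
  · have hR0 : (0 : ℝ) ≤ M * (B * √(2 * D) + 2) := by positivity
    calc ∑ n ∈ range T with bad (rounds D a r n), ∑ i, ρ n i
        -- The `+ 1` includes the final epoch, which no round need close.
        = ∑ p ∈ range (rounds D a r T + 1) with bad p,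
            ∑ n ∈ {n ∈ range T | bad (rounds D a r n)} with rounds D a r n = p, ∑ i, ρ n i := by
          refine (sum_fiberwise_of_maps_to (fun n hn => ?_) _).symm
          have hn' := mem_filter.1 hn
          exact mem_filter.2 ⟨mem_range.2 (Nat.lt_succ_of_le
            (rounds_mono (mem_range.1 hn'.1).le)), hn'.2⟩
      _ ≤ ∑ p ∈ range (rounds D a r T + 1) with bad p, M * (B * √(2 * D) + 2) := by
          refine sum_le_sum fun p hp => ?_
          have : {n ∈ {n ∈ range T | bad (rounds D a r n)} | rounds D a r n = p} =
              {n ∈ range T | rounds D a r n = p} := by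
            rw [filter_filter]
            refine filter_congr fun n _ => ⟨fun h => h.2, fun h => ⟨?_, h⟩⟩
            rw [h]
            exact (mem_filter.1 hp).2
          rw [this, sum_comm]
          calc _ ≤ ∑ _ : Fin M, (B * √(2 * D) + 2) := sum_le_sum fun i _ =>
                sum_epoch_le hD hB (fun n hn => h2 n hn i) (fun n hn => hw n hn i) p
            _ = _ := by rw [sum_const, card_univ, Fintype.card_fin, nsmul_eq_mul]
      _ ≤ R * (M * (B * √(2 * D) + 2)) := by
          rw [sum_const, nsmul_eq_mul]
          exact mul_le_mul_of_nonneg_right (card_large_increase_le T _ hR) hR0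

end Regret

/-! ### Optimism and the confidence ellipsoid. -/

section Optimism

variable {d : ℕ}

lemma euclNorm_le_one_iff {x : Vec d} : euclNorm x ≤ 1 ↔ x ⬝ᵥ x ≤ 1 := by
  rw [euclNorm, Real.sqrt_le_one]

lemma abs_dotProduct_le_one {x y : Vec d} (hx : euclNorm x ≤ 1) (hy : euclNorm y ≤ 1) :
    |x ⬝ᵥ y| ≤ 1 := by
  rw [euclNorm_le_one_iff] at hx hy
  have h := dotProduct_mulVec_sq_le (PosDef.one (n := Fin d) (R := ℝ)) x y
  simp only [one_mulVec] at h
  have h0 : 0 ≤ x ⬝ᵥ x := by simpa using dotProduct_star_self_nonneg x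
  rw [← sq_le_one_iff_abs_le_one]
  nlinarith

lemma bestValue_sub_le {θ x : Vec d} {A : Set (Vec d)} {b : ℝ} (hA : A.Nonempty)
    (h : ∀ z ∈ A, z ⬝ᵥ θ - x ⬝ᵥ θ ≤ b) : bestValue θ A - x ⬝ᵥ θ ≤ b := by
  rw [sub_le_iff_le_add]
  refine csSup_le (hA.image _) ?_
  rintro _ ⟨z, hz, rfl⟩
  linarith [h z hz]

lemma bestValue_sub_le_two {θ x : Vec d} {A : Set (Vec d)} (hA : ∀ z ∈ A, euclNorm z ≤ 1)
    (hx : x ∈ A) (hθ : euclNorm θ ≤ 1) : bestValue θ A - x ⬝ᵥ θ ≤ 2 :=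
  bestValue_sub_le ⟨x, hx⟩ fun z hz => by
    have h1 := abs_le.1 (abs_dotProduct_le_one (hA z hz) hθ)
    have h2 := abs_le.1 (abs_dotProduct_le_one (hA x hx) hθ)
    linarith [h1.2, h2.1]

lemma bestValue_sub_nonneg {θ x : Vec d} {A : Set (Vec d)} (hA : ∀ z ∈ A, euclNorm z ≤ 1)
    (hx : x ∈ A) (hθ : euclNorm θ ≤ 1) : 0 ≤ bestValue θ A - x ⬝ᵥ θ :=
  sub_nonneg.2 <| le_csSup ⟨1, by
    rintro _ ⟨z, hz, rfl⟩
    exact (abs_le.1 (abs_dotProduct_le_one (hA z hz) hθ)).2⟩ ⟨x, hx, rfl⟩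

/-- The radius of the confidence ellipsoid. -/
noncomputable def radius (δ : ℝ) (V : Matrix (Fin d) (Fin d) ℝ) : ℝ :=
  √(2 * Real.log (√V.det / δ)) + 1

/-- By optimism, `z ⬝ᵥ θ - x ⬝ᵥ θ ≤ x ⬝ᵥ (θ' - θ)`; both parameters lie in one ellipsoid, so their
distance is at most twice its radius. -/
lemma bestValue_sub_le_radius {M : ℕ} {δ : ℝ} {s : State M d} {i : Fin M} {A : Set (Vec d)}
    {x θ : Vec d} (hV : (s.V i).PosDef) (hx : s.IsOptimistic δ i A x) (hθ : θ ∈ s.confSet δ i) :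
    bestValue θ A - x ⬝ᵥ θ ≤ 2 * radius δ (s.V i) * √(invQuad (s.V i) x) := by
  obtain ⟨hxA, θ', hθ', hmax⟩ := hx
  refine bestValue_sub_le ⟨x, hxA⟩ fun z hz => ?_
  have h1 := hmax z hz θ hθ
  have h2 := dotProduct_le_matNorm hV x (θ' - θ)
  have h3 : matNorm (s.V i) (θ' - θ) ≤ 2 * radius δ (s.V i) := by
    have h4 := matNorm_add_le hV (-(s.thetaHat i - θ')) (s.thetaHat i - θ)
    rw [matNorm_neg, show -(s.thetaHat i - θ') + (s.thetaHat i - θ) = θ' - θ by abel] at h4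
    have h5 : matNorm (s.V i) (s.thetaHat i - θ') ≤ radius δ (s.V i) := hθ'
    have h6 : matNorm (s.V i) (s.thetaHat i - θ) ≤ radius δ (s.V i) := hθ
    linarith
  have h7 := mul_le_mul_of_nonneg_left h3 (Real.sqrt_nonneg (invQuad (s.V i) x))
  rw [dotProduct_sub] at h2
  linarith

lemma gram_mulVec {ι : Type*} (u : ι → Vec d) (s : Finset ι) (θ : Vec d) :
    gram u s *ᵥ θ = θ + ∑ k ∈ s, (u k ⬝ᵥ θ) • u k := by
  rw [gram, add_mulVec, one_mulVec, sum_mulVec]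
  congr 1
  refine sum_congr rfl fun k _ => ?_
  rw [vecMulVec_mulVec]
  simp

/-- The true parameter lies in the confidence ellipsoid whenever the self-normalized process of
the known samples is small. -/
lemma mem_confSet_of_selfNorm_lt {M : ℕ} [NeZero M] {D δ : ℝ} {a : ℕ → Fin M → Vec d}
    {r e : ℕ → Fin M → ℝ} {θ : Vec d} {n : ℕ} {i : Fin M} (hδ : 0 < δ) (hθ : euclNorm θ ≤ 1)
    (hr : ∀ n i, r n i = a n i ⬝ᵥ θ + e n i)
    (h : selfNorm (gram (flat a) (known D a r (rounds D a r n) i n))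
      (∑ k ∈ known D a r (rounds D a r n) i n, flat e k • flat a k) < 1 / δ) :
    θ ∈ (stateAfter D a r n).confSet δ i := by
  set K := known D a r (rounds D a r n) i n
  set V := gram (flat a) K with hVdef
  set S := ∑ k ∈ K, flat e k • flat a k
  have hV : V.PosDef := posDef_gram _ _
  have hVs : (stateAfter D a r n).V i = V := V_eq_gram n i
  -- The error splits into noise `V⁻¹S` and regularization bias `-V⁻¹θ`. The noise gives the
  -- logarithmic part of the radius; the bias is at most `‖θ‖ ≤ 1` since `V ≥ I`, giving the `+ 1`.
  have hest : (stateAfter D a r n).thetaHat i - θ = V⁻¹ *ᵥ (S + -θ) := by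
    rw [State.thetaHat, hVs, Usyn_add_Unew]
    have h1 : ∑ k ∈ K, flat r k • flat a k = V *ᵥ θ + (S + -θ) := by
      rw [hVdef, gram_mulVec, sum_congr rfl fun k _ => show flat r k • flat a k =
        (flat a k ⬝ᵥ θ) • flat a k + flat e k • flat a k by
          rw [← add_smul]; congr 1; exact hr _ _, sum_add_distrib]
      abel
    rw [h1, mulVec_add, inv_mulVec_mulVec hV]
    abel
  show matNorm _ _ ≤ _
  rw [hest, hVs, matNorm_inv_mulVec hV, ← matNorm_inv]
  refine (matNorm_add_le hV.inv _ _).trans ?_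
  rw [matNorm_neg, matNorm_inv, matNorm_inv]
  refine add_le_add (Real.sqrt_le_sqrt ?_) ?_
  · have hs : 0 < √V.det := Real.sqrt_pos.2 hV.det_pos
    rw [selfNorm, div_lt_iff₀ hs, one_div_mul_eq_div] at h
    have := (Real.lt_log_iff_exp_lt (by positivity)).2 h
    linarith
  · rw [Real.sqrt_le_one]
    exact (invQuad_gram_le_dotProduct _ _ _).trans (euclNorm_le_one_iff.1 hθ)

end Optimism

/-! ### Measurability of the protocol's matrices and rounds. -/

section Measurability

variable {Ω : Type*} {m : MeasurableSpace Ω} {M d : ℕ} {D : ℝ} {x : ℕ → Fin M → Ω → Vec d}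
  {r : Ω → ℕ → Fin M → ℝ}

lemma measurable_apply_apply_of_eq_ite {W W₁ W₂ : Ω → Matrix (Fin d) (Fin d) ℝ} {E : Set Ω}
    (hE : MeasurableSet E) (h₁ : ∀ a b, Measurable fun ω => W₁ ω a b)
    (h₂ : ∀ a b, Measurable fun ω => W₂ ω a b) (hp : ∀ ω ∈ E, W ω = W₁ ω)
    (hn : ∀ ω ∉ E, W ω = W₂ ω) (a b : Fin d) : Measurable fun ω => W ω a b := by
  classical
  have : (fun ω => W ω a b) = fun ω => if ω ∈ E then W₁ ω a b else W₂ ω a b := by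
    ext ω
    split_ifs with h
    · rw [hp ω h]
    · rw [hn ω h]
  rw [this]
  exact Measurable.ite hE (h₁ a b) (h₂ a b)

lemma measurable_nat_of_eq_ite {f f₁ f₂ : Ω → ℕ} {E : Set Ω}
    (hE : MeasurableSet E) (h₁ : Measurable f₁) (h₂ : Measurable f₂) (hp : ∀ ω ∈ E, f ω = f₁ ω)
    (hn : ∀ ω ∉ E, f ω = f₂ ω) : Measurable f := by
  classical
  have : f = fun ω => if ω ∈ E then f₁ ω else f₂ ω := by
    ext ω
    split_ifs with h
    · rw [hp ω h]
    · rw [hn ω h]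
  rw [this]
  exact Measurable.ite hE h₁ h₂

/-- The matrices of the protocol and the communication rounds depend only on the actions. -/
lemma measurable_stateAfter {n : ℕ} (hx : ∀ k < n, ∀ i, Measurable (x k i)) :
    (∀ a b, Measurable fun ω => (stateAfter D (fun k i => x k i ω) (r ω) n).Wsyn a b) ∧
    (∀ i a b, Measurable fun ω => (stateAfter D (fun k i => x k i ω) (r ω) n).Wnew i a b) ∧
    (Measurable fun ω => (stateAfter D (fun k i => x k i ω) (r ω) n).tlast) ∧
    Measurable fun ω => rounds D (fun k i => x k i ω) (r ω) n := by
  induction n with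
  | zero =>
    refine ⟨fun _ _ => measurable_const, fun _ _ _ => measurable_const, measurable_const, ?_⟩
    simp only [rounds_zero]
    exact measurable_const
  | succ n ih =>
    obtain ⟨hWs, hWn, ht, hr⟩ := ih fun k hk => hx k (by omega)
    have hxn := hx n n.lt_succ_self
    have hWr : ∀ i a b, Measurable fun ω =>
        (recorded D (fun k i => x k i ω) (r ω) n).Wnew i a b :=
      fun i => measurable_add_vecMulVec (hWn i) (hxn i)
    have hVl : ∀ a b, Measurable fun ω =>
        (recorded D (fun k i => x k i ω) (r ω) n).Vlast a b :=
      fun a b => measurable_const.add (hWs a b)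
    have hV : ∀ i a b, Measurable fun ω =>
        (recorded D (fun k i => x k i ω) (r ω) n).V i a b :=
      fun i a b => (hVl a b).add (hWr i a b)
    have hE : MeasurableSet {ω | Syncs D (fun k i => x k i ω) (r ω) n} := by
      simp only [Syncs, Set.ofPred_exists]
      refine MeasurableSet.iUnion fun i => measurableSet_lt measurable_const ?_
      have ht' : Measurable fun ω =>
          ((recorded D (fun k i => x k i ω) (r ω) n).tlast : ℝ) :=
        (measurable_from_nat (f := fun k : ℕ => (k : ℝ))).comp ht
      exact (((measurable_det (hV i)).div (measurable_det hVl)).log).mul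
        (measurable_const.sub ht')
    refine ⟨?_, fun i => ?_, ?_, ?_⟩
    · refine measurable_apply_apply_of_eq_ite hE (W₁ := fun ω =>
        (stateAfter D (fun k i => x k i ω) (r ω) n).Wsyn +
          ∑ j, (recorded D (fun k i => x k i ω) (r ω) n).Wnew j) (fun a b => ?_) hWs
        (fun ω h => ?_) (fun ω h => ?_)
      · simp only [Matrix.add_apply, Matrix.sum_apply]
        exact (hWs a b).add (Finset.measurable_fun_sum _ fun j _ => hWr j a b)
      · rw [stateAfter_succ_of_pos h]; rfl
      · rw [stateAfter_succ_of_neg h]; rfl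
    · refine measurable_apply_apply_of_eq_ite hE (W₁ := fun _ => 0)
        (fun a b => measurable_const) (hWr i) (fun ω h => ?_) (fun ω h => ?_)
      · rw [stateAfter_succ_of_pos h]; rfl
      · rw [stateAfter_succ_of_neg h]
    · refine measurable_nat_of_eq_ite hE (f₁ := fun _ => n + 1) measurable_const ht
        (fun ω h => ?_) (fun ω h => ?_)
      · rw [stateAfter_succ_of_pos h]; rfl
      · rw [stateAfter_succ_of_neg h]; rfl
    · exact measurable_nat_of_eq_ite hE (hr.add_const 1) hr
        (fun ω h => rounds_succ_of_pos h) (fun ω h => rounds_succ_of_neg h)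

end Measurability

/-! ### Concentration for a fixed round number and agent. -/

section Concentration

variable {Ω : Type*} {mΩ : MeasurableSpace Ω} {μ : Measure Ω} [IsProbabilityMeasure μ]
  {ℱ : Filtration ℕ mΩ} {M d T : ℕ} [NeZero M] {D : ℝ} {θstar : Vec d} {A : ℕ → Ω → Set (Vec d)}
  {η : ℕ → Fin M → Ω → ℝ} {x : ℕ → Fin M → Ω → Vec d}

/-- The trajectory at `ω` has a large self-normalized noise for the samples that are known to agent
`i` between the rounds `p` and `p + 1`. -/
def LargeNoise (D : ℝ) (T : ℕ) (c : ℝ) (θstar : Vec d) (η : ℕ → Fin M → Ω → ℝ)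
    (x : ℕ → Fin M → Ω → Vec d) (p : ℕ) (i : Fin M) (ω : Ω) : Prop :=
  ∃ n ≤ T, c ≤ selfNorm
    (gram (flat fun n j => x n j ω) (known D (fun n j => x n j ω) (reward θstar x η ω) p i n))
    (∑ k ∈ known D (fun n j => x n j ω) (reward θstar x η ω) p i n,
      flat (fun n j => η n j ω) k • flat (fun n j => x n j ω) k)

lemma IsLinearBandit.mul_measureReal_largeNoise_le (h : IsLinearBandit μ ℱ T θstar A η x)
    {c : ℝ} (hc : 1 ≤ c) (p : ℕ) (i : Fin M) :
    c * μ.real {ω | LargeNoise D T c θstar η x p i ω} ≤ 1 := by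
  classical
  -- Unknown samples are replaced by zero, which leaves Gram matrix and noise sum unchanged. For
  -- fixed `p` and `i` the selection at `k` depends only on actions of steps before that of `k`, so
  -- `z` is predictable.
  set z : ℕ → Ω → Vec d := fun k ω =>
    if rounds D (fun n j => x n j ω) (reward θstar x η ω) (k / M) < p ∨ Fin.ofNat M k = i then
      flat (fun n j => x n j ω) k else 0 with hz
  have hdiv : ∀ k < T * M, k / M < T := fun k hk => (Nat.div_lt_iff_lt_mul (NeZero.pos M)).2 hk
  have hidx : ∀ k, k / M * M + (Fin.ofNat M k : ℕ) = k := fun k => by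
    rw [Fin.val_ofNat, Nat.div_add_mod']
  have hzm : ∀ k < T * M, Measurable[ℱ k] (z k) := fun k hk => by
    have hle : k / M * M ≤ k := Nat.div_mul_le_self k M
    have hr := (measurable_stateAfter (m := ℱ k) (D := D) (r := reward θstar x η) (n := k / M)
      fun l hl j => (h.action_meas l (hl.trans (hdiv k hk)) j).mono
        (ℱ.mono ((Nat.mul_le_mul_right _ hl.le).trans hle)) le_rfl).2.2.2
    refine Measurable.ite ?_ ((h.action_meas _ (hdiv k hk) _).mono (ℱ.mono hle) le_rfl)
      measurable_const
    exact (measurableSet_lt hr measurable_const).union (MeasurableSet.const _)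
  have hmain := mul_measureReal_exists_selfNorm_le (μ := μ) (ℱ := ℱ) (n := T * M)
    (e := fun k ω => flat (fun n j => η n j ω) k) (z := z) hc hzm
    (fun k hk => by
      have := h.noise_meas (k / M) (hdiv k hk) (Fin.ofNat M k)
      rwa [hidx] at this)
    (fun k hk => h.noise_mem (k / M) (hdiv k hk) (Fin.ofNat M k))
    (fun k hk => by
      have := h.noise_mean (k / M) (hdiv k hk) (Fin.ofNat M k)
      rwa [hidx] at this)
  refine (mul_le_mul_of_nonneg_left (measureReal_mono ?_ (measure_ne_top _ _))
    (by linarith)).trans hmain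
  rintro ω ⟨n, hn, hω⟩
  refine ⟨n * M, Nat.mul_le_mul_right _ hn, hω.trans_eq ?_⟩
  congr 1
  · rw [gram, gram, known, sum_filter]
    congr 1
    refine sum_congr rfl fun k _ => ?_
    simp only [hz]
    split_ifs <;> simp
  · rw [known, sum_filter]
    refine sum_congr rfl fun k _ => ?_
    simp only [hz]
    split_ifs <;> simp

end Concentration

/-! ### Numerical consequences of the choice of `D` and `δ`. -/

section Constants

variable {M d T : ℕ}

lemma one_le_log_mul (hM : 0 < M) (hT : 2 < T) : 1 ≤ Real.log (M * T) := by
  have h1 : (1 : ℝ) ≤ M := by exact_mod_cast hM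
  have h2 : (3 : ℝ) ≤ T := by exact_mod_cast hT
  rw [Real.le_log_iff_exp_le (by positivity)]
  have := Real.exp_one_lt_d9
  nlinarith

lemma log_det_gram_le_two_mul (hM : 0 < M) (hT : 2 < T) {u : ℕ → Vec d}
    (hu : ∀ k < T * M, u k ⬝ᵥ u k ≤ 1) :
    Real.log (gram u (range (T * M))).det ≤ 2 * d * Real.log (M * T) := by
  have h1 : (1 : ℝ) ≤ M := by exact_mod_cast hM
  have h2 : (3 : ℝ) ≤ T := by exact_mod_cast hT
  have h3 := log_det_gram_le u (range (T * M)) fun k hk => hu k (mem_range.1 hk)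
  rw [card_range] at h3
  have h4 : Real.log (1 + ((T * M : ℕ) : ℝ)) ≤ 2 * Real.log (M * T) := by
    rw [← Nat.cast_two, ← Real.log_pow]
    refine Real.log_le_log (by positivity) ?_
    push_cast
    have : (3 : ℝ) ≤ M * T := by nlinarith
    nlinarith
  calc _ ≤ _ := h3
    _ ≤ d * (2 * Real.log (M * T)) := by gcongr
    _ = _ := by ring

lemma log_mul_le (hM : 0 < M) (hMT : M < T) : Real.log (M * T) ≤ 2 * Real.log T := by
  have h1 : (1 : ℝ) ≤ M := by exact_mod_cast hM
  have h2 : (M : ℝ) ≤ T := by exact_mod_cast hMT.le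
  have h3 : (0 : ℝ) < T := by linarith
  rw [Real.log_mul (by positivity) (by positivity), two_mul]
  gcongr

lemma threshold_pos (hM : 0 < M) (hd : 0 < d) (hT : 2 < T) : 0 < threshold M d T := by
  have h1 : (0 : ℝ) < M := by exact_mod_cast hM
  have h2 : (0 : ℝ) < d := by exact_mod_cast hd
  have h3 : (0 : ℝ) < T := by exact_mod_cast (by omega : 0 < T)
  have := one_le_log_mul hM hT
  unfold threshold
  positivity

lemma rounds_le [NeZero M] (hd : 0 < d) (hT : 2 < T) {a : ℕ → Fin M → Vec d}
    {r : ℕ → Fin M → ℝ} (ha : ∀ n < T, ∀ i, euclNorm (a n i) ≤ 1) :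
    (rounds (threshold M d T) a r T : ℝ) ≤ 2 * (d * √M) := by
  have hM := NeZero.pos M
  have hD := threshold_pos hM hd hT
  set D := threshold M d T with hDdef
  have h1 : (0 : ℝ) < M := by exact_mod_cast hM
  have h2 : (0 : ℝ) < d := by exact_mod_cast hd
  have h3 : (0 : ℝ) < T := by exact_mod_cast (by omega : 0 < T)
  have hL := one_le_log_mul hM hT
  have hs := Real.sq_sqrt hD.le
  have hsM := Real.sq_sqrt h1.le
  have hsD : 0 < √D := Real.sqrt_pos.2 hD
  have hsM0 : 0 < √(M : ℝ) := Real.sqrt_pos.2 h1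
  -- This weight makes the time term at most `√D·d√M` and the log-determinant term at most
  -- `2√D·d√M`.
  have hc : 0 < √D * (d * √M / T) := by positivity
  have h4 := rounds_mul_le (D := D) (a := a) (r := r) hc T
  have h5 : ((stateAfter D a r T).tlast : ℝ) ≤ T := by exact_mod_cast tlast_le T
  have h6 := (log_det_Vlast_le (D := D) (a := a) (r := r) le_rfl).trans
    (log_det_gram_le_two_mul (d := d) hM hT (u := flat a) fun k hk => euclNorm_le_one_iff.1
      (ha _ ((Nat.div_lt_iff_lt_mul hM).2 hk) _))
  have h7 : √D * (d * √M / T) * (stateAfter D a r T).tlast ≤ √D * (d * √M) := by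
    calc _ ≤ √D * (d * √M / T) * T := by gcongr
      _ = _ := by field_simp
  have h8 : Real.log (stateAfter D a r T).Vlast.det / (√D * (d * √M / T)) ≤
      √D * (2 * (d * √M)) := by
    rw [div_le_iff₀ hc]
    refine h6.trans_eq ?_
    have : √D * (2 * (d * √M)) * (√D * (d * √M / T)) = √D ^ 2 * √(M : ℝ) ^ 2 * (2 * d ^ 2 / T) := by
      ring
    rw [this, hs, hsM, hDdef, threshold]
    field_simp
  have h9 : √D * (2 * (rounds D a r T : ℝ)) ≤ √D * (3 * (d * √M)) := by linarith
  have h10 := le_of_mul_le_mul_left h9 hsD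
  have : 0 ≤ d * √(M : ℝ) := by positivity
  linarith

/-- Evaluates `sum_le_of_le_width` at `B = 8√(dL)`, `R = 2dL` and the actual threshold; `60 = 32 +
24 + 4`. The last summand uses `M ≤ √(MT)`, that is, `M ≤ T`. -/
lemma regret_bound_le (hM : 0 < M) (hd : 0 < d) (hMT : M < T) (hT : 2 < T) :
    8 * √(d * Real.log (M * T)) * √(T * M * (6 * (2 * d * Real.log (M * T)))) +
      2 * d * Real.log (M * T) * (M * (8 * √(d * Real.log (M * T)) *
        √(2 * threshold M d T) + 2)) ≤ 60 * (d * √(M * T) * Real.log (M * T) ^ 2) := by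
  have hL := one_le_log_mul hM hT
  rw [threshold]
  generalize Real.log (M * T) = L at *
  have h1 : (0 : ℝ) < M := by exact_mod_cast hM
  have h2 : (0 : ℝ) < d := by exact_mod_cast hd
  have h3 : (0 : ℝ) < T := by exact_mod_cast (by omega : 0 < T)
  have h4 : (M : ℝ) ≤ T := by exact_mod_cast hMT.le
  set s := √((M : ℝ) * T)
  have hs : s ^ 2 = M * T := Real.sq_sqrt (by positivity)
  have hs0 : 0 ≤ s := Real.sqrt_nonneg _
  have e1 : √(d * L) * √(T * M * (6 * (2 * d * L))) ≤ 4 * (d * L * s) := by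
    rw [← Real.sqrt_mul (by positivity)]
    refine Real.sqrt_le_iff.2 ⟨by positivity, ?_⟩
    have : (4 * (d * L * s)) ^ 2 = 16 * (d * L) ^ 2 * (M * T) := by rw [← hs]; ring
    rw [this]
    have : 0 ≤ (d * L) ^ 2 * (M * T) := by positivity
    nlinarith
  have e2 : M * (√(d * L) * √(2 * (T * L / (d * M)))) ≤ 3 / 2 * (L * s) := by
    rw [← Real.sqrt_mul (by positivity)]
    have : (d * L) * (2 * (T * L / (d * M))) = 2 * L ^ 2 * T / M := by field_simp
    rw [this, mul_comm, ← le_div_iff₀ h1]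
    refine Real.sqrt_le_iff.2 ⟨by positivity, ?_⟩
    have : (3 / 2 * (L * s) / M) ^ 2 = 9 / 4 * L ^ 2 * T / M := by
      rw [div_pow, mul_pow, mul_pow, hs]; field_simp; norm_num
    rw [this]
    gcongr
    norm_num
  have e3 : (M : ℝ) ≤ s := Real.le_sqrt_of_sq_le (by nlinarith)
  have e4 : L ≤ L ^ 2 := by nlinarith
  have f1 : d * L * s ≤ d * s * L ^ 2 := by
    calc d * L * s = d * s * L := by ring
      _ ≤ _ := by gcongr
  have f2 : d * L * (M * (√(d * L) * √(2 * (T * L / (d * M))))) ≤ 3 / 2 * (d * s * L ^ 2) := by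
    calc _ ≤ d * L * (3 / 2 * (L * s)) := by gcongr
      _ = _ := by ring
  have f3 : d * L * M ≤ d * s * L ^ 2 := by
    calc d * L * M ≤ d * L * s := by gcongr
      _ ≤ _ := f1
  linarith

/-- Half the log-determinant contributes `dL` and `log(1/δ)` at most `2L`. Then `√(6dL) ≤ 3√(dL)`,
and the `+ 1` is absorbed because `dL ≥ 1`. -/
lemma radius_le {V : Matrix (Fin d) (Fin d) ℝ} (hM : 0 < M) (hd : 0 < d) (hT : 2 < T)
    (hV : 0 < V.det) (h : Real.log V.det ≤ 2 * d * Real.log (M * T)) :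
    radius (confLevel M T) V ≤ 4 * √(d * Real.log (M * T)) := by
  have h1 : (1 : ℝ) ≤ M := by exact_mod_cast hM
  have h2 : (1 : ℝ) ≤ d := by exact_mod_cast hd
  have h3 : (1 : ℝ) ≤ T := by exact_mod_cast (by omega : 1 ≤ T)
  have hL := one_le_log_mul hM hT
  have hδ : Real.log (√V.det / confLevel M T) ≤ 3 * (d * Real.log (M * T)) := by
    have h4 : √V.det / confLevel M T = √V.det * ((M : ℝ) ^ 2 * T) := by
      rw [confLevel]; field_simp
    rw [h4, Real.log_mul (Real.sqrt_pos.2 hV).ne' (by positivity), Real.log_sqrt hV.le]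
    have h5 : Real.log ((M : ℝ) ^ 2 * T) ≤ 2 * Real.log (M * T) := by
      rw [show 2 * Real.log (M * T) = Real.log ((M * T) ^ 2) by rw [Real.log_pow]; norm_num]
      refine Real.log_le_log (by positivity) ?_
      rw [mul_pow]
      gcongr
      nlinarith
    have h6 : Real.log (M * T) ≤ d * Real.log (M * T) := le_mul_of_one_le_left (by linarith) h2
    linarith
  generalize Real.log (M * T) = L at *
  have hX : 1 ≤ d * L := by nlinarith
  have h7 : 1 ≤ √(d * L) := Real.one_le_sqrt.2 hX
  have h8 : √(2 * Real.log (√V.det / confLevel M T)) ≤ 3 * √(d * L) := by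
    refine Real.sqrt_le_iff.2 ⟨by positivity, ?_⟩
    rw [mul_pow, Real.sq_sqrt (by positivity)]
    linarith
  rw [radius]
  linarith

end Constants

/-! ### Expected regret and communication cost. -/

section Main

variable {Ω : Type*} {mΩ : MeasurableSpace Ω} {μ : Measure Ω}
  {ℱ : Filtration ℕ mΩ} {M d T : ℕ} {θstar : Vec d} {A : ℕ → Ω → Set (Vec d)}
  {η : ℕ → Fin M → Ω → ℝ} {x : ℕ → Fin M → Ω → Vec d}

lemma IsLinearBandit.norm_action_le (h : IsLinearBandit μ ℱ T θstar A η x)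
    (hf : FollowsDisLinUCB T θstar A η x) {n : ℕ} (hn : n < T) (i : Fin M) (ω : Ω) :
    euclNorm (x n i ω) ≤ 1 := h.action_le n hn ω _ (hf n hn i ω).1

lemma IsLinearBandit.regret_term_le_two (h : IsLinearBandit μ ℱ T θstar A η x)
    (hf : FollowsDisLinUCB T θstar A η x) {n : ℕ} (hn : n < T) (i : Fin M) (ω : Ω) :
    bestValue θstar (A n ω) - x n i ω ⬝ᵥ θstar ≤ 2 :=
  bestValue_sub_le_two (h.action_le n hn ω) (hf n hn i ω).1 h.theta_le

lemma IsLinearBandit.regret_nonneg (h : IsLinearBandit μ ℱ T θstar A η x)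
    (hf : FollowsDisLinUCB T θstar A η x) (ω : Ω) : 0 ≤ regret T θstar A x ω :=
  sum_nonneg fun n hn => sum_nonneg fun i _ =>
    bestValue_sub_nonneg (h.action_le n (mem_range.1 hn) ω) (hf n (mem_range.1 hn) i ω).1
      h.theta_le

lemma IsLinearBandit.regret_le (h : IsLinearBandit μ ℱ T θstar A η x)
    (hf : FollowsDisLinUCB T θstar A η x) (ω : Ω) : regret T θstar A x ω ≤ 2 * M * T := by
  calc regret T θstar A x ω ≤ ∑ n ∈ range T, ∑ i : Fin M, (2 : ℝ) :=
        sum_le_sum fun n hn => sum_le_sum fun i _ =>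
          h.regret_term_le_two hf (mem_range.1 hn) i ω
    _ = 2 * M * T := by simp; ring

lemma IsLinearBandit.measurable_regret (h : IsLinearBandit μ ℱ T θstar A η x) :
    Measurable (regret T θstar A x) := by
  refine Finset.measurable_fun_sum _ fun n hn => Finset.measurable_fun_sum _ fun i _ => ?_
  have hn' := mem_range.1 hn
  have hx : Measurable (x n i) := (h.action_meas n hn' i).mono (ℱ.le _) le_rfl
  refine (h.best_meas n hn').sub ?_
  simp only [dotProduct]
  exact Finset.measurable_fun_sum _ fun j _ =>
    ((measurable_pi_apply j).comp hx).mul measurable_const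

lemma IsLinearBandit.integrable_regret [IsProbabilityMeasure μ]
    (h : IsLinearBandit μ ℱ T θstar A η x)
    (hf : FollowsDisLinUCB T θstar A η x) : Integrable (regret T θstar A x) μ :=
  .of_bound h.measurable_regret.aestronglyMeasurable (2 * M * T) <| .of_forall fun ω => by
    rw [Real.norm_eq_abs, abs_of_nonneg (h.regret_nonneg hf ω)]
    exact h.regret_le hf ω

variable [NeZero M]

lemma log_det_V_le (hT : 2 < T) {D : ℝ} {a : ℕ → Fin M → Vec d} {r : ℕ → Fin M → ℝ}
    (ha : ∀ n < T, ∀ i, euclNorm (a n i) ≤ 1) {n : ℕ} (hn : n < T) (i : Fin M) :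
    Real.log ((stateAfter D a r n).V i).det ≤ 2 * d * Real.log (M * T) := by
  rw [V_eq_gram]
  refine (Real.log_le_log (posDef_gram _ _).det_pos (det_gram_mono _
    ((filter_subset _ _).trans (range_mono (Nat.mul_le_mul_right M hn.le))))).trans ?_
  exact log_det_gram_le_two_mul (NeZero.pos M) hT fun k hk => euclNorm_le_one_iff.1
    (ha _ ((Nat.div_lt_iff_lt_mul (NeZero.pos M)).2 hk) _)

/-- The regret on trajectories without large noise. -/
lemma IsLinearBandit.regret_le_of_not_largeNoise (hd : 0 < d) (hMT : M < T) (hT : 2 < T)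
    (h : IsLinearBandit μ ℱ T θstar A η x) (hf : FollowsDisLinUCB T θstar A η x) {ω : Ω}
    (hω : ∀ (p : ℕ) i, (p : ℝ) ≤ 2 * (d * √M) →
      ¬ LargeNoise (threshold M d T) T (1 / confLevel M T) θstar η x p i ω) :
    regret T θstar A x ω ≤ 60 * (d * √(M * T) * Real.log (M * T) ^ 2) := by
  have hM := NeZero.pos M
  have h1 : (0 : ℝ) < M := by exact_mod_cast hM
  have h3 : (0 : ℝ) < T := by exact_mod_cast (by omega : 0 < T)
  have hd1 : (1 : ℝ) ≤ d := by exact_mod_cast hd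
  have hL := one_le_log_mul hM hT
  have hδ : 0 < confLevel M T := by unfold confLevel; positivity
  have ha : ∀ n < T, ∀ i, euclNorm (x n i ω) ≤ 1 := fun n hn i => h.norm_action_le hf hn i ω
  have hB1 : 1 ≤ √(d * Real.log (M * T)) := Real.one_le_sqrt.2 (by nlinarith)
  refine le_trans ?_ (regret_bound_le hM hd hMT hT)
  refine sum_le_of_le_width (D := threshold M d T) (a := fun n i => x n i ω)
    (r := reward θstar x η ω) (threshold_pos hM hd hT).le (by positivity)
    (fun n hn i => h.regret_term_le_two hf hn i ω) (fun n hn i => ?_)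
    (log_det_gram_le_two_mul hM hT fun k hk => euclNorm_le_one_iff.1
      (ha _ ((Nat.div_lt_iff_lt_mul hM).2 hk) _))
  have hconf : θstar ∈ (stateAfter (threshold M d T) (fun n i => x n i ω)
      (reward θstar x η ω) n).confSet (confLevel M T) i := by
    refine mem_confSet_of_selfNorm_lt (e := fun n i => η n i ω) hδ h.theta_le
      (fun _ _ => rfl) (not_le.1 fun hle => hω _ i ?_ ⟨n, hn.le, hle⟩)
    refine le_trans ?_ (rounds_le (r := reward θstar x η ω) hd hT ha)
    exact_mod_cast rounds_mono hn.le
  have hV := posDef_V (D := threshold M d T) (a := fun n i => x n i ω)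
    (r := reward θstar x η ω) n i
  have hreg := bestValue_sub_le_radius hV (hf n hn i ω) hconf
  have hrad := radius_le hM hd hT hV.det_pos (log_det_V_le hT ha hn i)
  -- For widths above 1 the trivial bound 2 is already below `B = 8√(dL)`; this allows the
  -- truncation at 1.
  rcases le_total 1 (width (threshold M d T) (fun n i => x n i ω) (reward θstar x η ω) n i)
    with hw | hw
  · rw [min_eq_left hw, Real.sqrt_one]
    linarith [h.regret_term_le_two hf hn i ω]
  · rw [min_eq_right hw]
    refine hreg.trans ?_
    exact mul_le_mul_of_nonneg_right (by linarith) (Real.sqrt_nonneg _)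

theorem IsLinearBandit.integral_regret_le [IsProbabilityMeasure μ] (hd : 0 < d)
    (hMT : M < T) (hT : 2 < T)
    (h : IsLinearBandit μ ℱ T θstar A η x) (hf : FollowsDisLinUCB T θstar A η x) :
    ∫ ω, regret T θstar A x ω ∂μ ≤ 250 * (d * √(M * T) * Real.log T ^ 2) := by
  have hM := NeZero.pos M
  have h1 : (1 : ℝ) ≤ M := by exact_mod_cast hM
  have h3 : (1 : ℝ) ≤ T := by exact_mod_cast (by omega : 1 ≤ T)
  have hd1 : (1 : ℝ) ≤ d := by exact_mod_cast hd
  have hL := one_le_log_mul hM hT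
  have hL2 := log_mul_le hM hMT
  set c := 1 / confLevel M T with hc
  have hcv : c = (M : ℝ) ^ 2 * T := by rw [hc, confLevel, one_div_one_div]
  have hc1 : 1 ≤ c := by
    rw [hcv]
    exact one_le_mul_of_one_le_of_one_le (one_le_pow₀ h1) h3
  set Q := ⌊2 * (d * √(M : ℝ))⌋₊ + 1 with hQ
  have hsM : 1 ≤ √(M : ℝ) := Real.one_le_sqrt.2 h1
  have hQle : (Q : ℝ) ≤ 3 * (d * √M) := by
    have := Nat.floor_le (show 0 ≤ 2 * (d * √(M : ℝ)) by positivity)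
    rw [hQ]
    push_cast
    nlinarith
  set E : Set Ω := ⋃ q ∈ range Q ×ˢ (univ : Finset (Fin M)),
    {ω | LargeNoise (threshold M d T) T c θstar η x q.1 q.2 ω} with hE
  have hEμ : μ.real E ≤ Q * M / c := by
    calc μ.real E ≤ ∑ q ∈ range Q ×ˢ (univ : Finset (Fin M)),
          μ.real {ω | LargeNoise (threshold M d T) T c θstar η x q.1 q.2 ω} :=
          measureReal_biUnion_finset_le _ _
      _ ≤ ∑ q ∈ range Q ×ˢ (univ : Finset (Fin M)), 1 / c := sum_le_sum fun q _ => by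
          rw [le_div_iff₀' (by linarith)]
          exact h.mul_measureReal_largeNoise_le hc1 _ _
      _ = Q * M / c := by
          rw [sum_const, card_product, card_range, card_univ, Fintype.card_fin, nsmul_eq_mul]
          push_cast
          ring
  set X := 60 * (d * √(M * T) * Real.log (M * T) ^ 2) with hX
  have hX0 : 0 ≤ X := by positivity
  -- A measurable hull of the same measure avoids proving the bad event measurable.
  set E' := toMeasurable μ E
  have hE'm : MeasurableSet E' := measurableSet_toMeasurable _ _
  have hE'μ : μ.real E' = μ.real E := by rw [measureReal_def, measure_toMeasurable, measureReal_def]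
  have hint : Integrable (fun ω => X + E'.indicator (fun _ => 2 * (M : ℝ) * T) ω) μ :=
    (integrable_const _).add ((integrable_const _).indicator hE'm)
  have hbound : ∀ ω, regret T θstar A x ω ≤ X + E'.indicator (fun _ => 2 * (M : ℝ) * T) ω := by
    intro ω
    by_cases hω : ω ∈ E'
    · rw [Set.indicator_of_mem hω]
      linarith [h.regret_le hf ω]
    · rw [Set.indicator_of_notMem hω, add_zero]
      refine h.regret_le_of_not_largeNoise hd hMT hT hf fun p i hp hn => hω ?_
      refine subset_toMeasurable _ _ (Set.mem_iUnion₂.2 ⟨(p, i), ?_, hn⟩)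
      exact mem_product.2 ⟨mem_range.2 (Nat.lt_succ_of_le (Nat.le_floor hp)), mem_univ _⟩
  -- With `1/δ = M²T` the factors `M` and `T` cancel, leaving `2Q`.
  have hfail : 2 * M * T * (Q * M / c) ≤ 6 * (d * √(M : ℝ)) := by
    have : 2 * M * T * (Q * M / c) = 2 * (Q : ℝ) := by
      rw [hcv]; field_simp
    linarith
  have hsMT : √(M : ℝ) ≤ √(M * T) := Real.sqrt_le_sqrt (by nlinarith)
  have hLT : 1 ≤ Real.log T ^ 2 := by
    have : 1 ≤ Real.log T := by simpa using one_le_log_mul one_pos hT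
    exact one_le_pow₀ this
  have hLL : Real.log (M * T) ^ 2 ≤ 4 * Real.log T ^ 2 := by nlinarith
  calc ∫ ω, regret T θstar A x ω ∂μ
      ≤ ∫ ω, (X + E'.indicator (fun _ => 2 * (M : ℝ) * T) ω) ∂μ :=
        integral_mono (h.integrable_regret hf) hint hbound
    _ = X + 2 * M * T * μ.real E := by
        rw [integral_add (integrable_const _) ((integrable_const _).indicator hE'm),
          integral_indicator_const _ hE'm, hE'μ]
        simp [mul_comm]
    _ ≤ X + 2 * M * T * (Q * M / c) := by gcongr
    _ ≤ X + 6 * (d * √M) := by linarith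
    _ ≤ 240 * (d * √(M * T) * Real.log T ^ 2) + 10 * (d * √(M * T) * Real.log T ^ 2) := by
        refine add_le_add ?_ ?_
        · calc X ≤ 60 * (d * √(M * T) * (4 * Real.log T ^ 2)) :=
              mul_le_mul_of_nonneg_left
                (mul_le_mul_of_nonneg_left hLL (by positivity)) (by norm_num)
            _ = _ := by ring
        · calc 6 * (d * √(M : ℝ)) ≤ 10 * (d * √(M * T) * 1) := by
                rw [mul_one]
                have : d * √(M : ℝ) ≤ d * √(M * T) :=
                  mul_le_mul_of_nonneg_left hsMT (by positivity)
                have : 0 ≤ d * √(M : ℝ) := by positivity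
                linarith
            _ ≤ _ := by gcongr
    _ = _ := by ring

theorem commCost_le_mul (hd : 0 < d) (hT : 2 < T) {a : ℕ → Fin M → Vec d}
    {r : ℕ → Fin M → ℝ} (ha : ∀ n < T, ∀ i, euclNorm (a n i) ≤ 1) :
    (commCost (threshold M d T) T a r : ℝ) ≤ 12 * ((M : ℝ) ^ (3 / 2 : ℝ) * (d : ℝ) ^ 3) := by
  have h1 : (0 : ℝ) < M := by exact_mod_cast NeZero.pos M
  have hd1 : (1 : ℝ) ≤ d := by exact_mod_cast hd
  have hpow : (M : ℝ) ^ (3 / 2 : ℝ) = M * √M := by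
    rw [show (3 / 2 : ℝ) = 1 + 1 / 2 by norm_num, Real.rpow_add h1, Real.rpow_one,
      Real.sqrt_eq_rpow]
  calc (commCost (threshold M d T) T a r : ℝ)
      ≤ rounds (threshold M d T) a r T * (2 * M + 2 * (M * (d ^ 2 + d))) := by
        exact_mod_cast commCost_le T
    _ ≤ 2 * (d * √M) * (2 * M + 2 * (M * (d ^ 2 + d))) := by
        gcongr
        exact rounds_le hd hT ha
    _ = 4 * (M * √M) * d * (1 + d + d ^ 2) := by ring
    _ ≤ 4 * (M * √M) * d * (3 * d ^ 2) := by
        gcongr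
        nlinarith
    _ = 12 * ((M : ℝ) ^ (3 / 2 : ℝ) * (d : ℝ) ^ 3) := by rw [hpow]; ring

end Main

end DisLinUCB

theorem theorem4 :
    ∃ C : ℝ, 0 < C ∧ ∀ (M d T : ℕ), 0 < M → 0 < d → M < T → 2 < T →
      ∀ (Ω : Type*) (mΩ : MeasurableSpace Ω) (μ : Measure Ω) (_ : IsProbabilityMeasure μ)
        (ℱ : Filtration ℕ mΩ) (θstar : DisLinUCB.Vec d) (A : ℕ → Ω → Set (DisLinUCB.Vec d))
        (η : ℕ → Fin M → Ω → ℝ) (x : ℕ → Fin M → Ω → DisLinUCB.Vec d),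
        DisLinUCB.IsLinearBandit μ ℱ T θstar A η x →
        DisLinUCB.FollowsDisLinUCB T θstar A η x →
          (Integrable (DisLinUCB.regret T θstar A x) μ ∧
            ∫ ω, DisLinUCB.regret T θstar A x ω ∂μ ≤
              C * (d * √((M : ℝ) * T) * Real.log T ^ 2)) ∧
          ∀ ω, (DisLinUCB.commCost (DisLinUCB.threshold M d T) T (fun n i => x n i ω)
              (DisLinUCB.reward θstar x η ω) : ℝ) ≤
            C * ((M : ℝ) ^ (3 / 2 : ℝ) * (d : ℝ) ^ 3) := by
  -- For the regret, `250 = 60·4 + 10`: the 4 comes from `log(MT) ≤ 2 log T`, and the 10 covers the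
  -- bad event. The communication bound needs only 12.
  refine ⟨250, by norm_num, ?_⟩
  intro M d T hM hd hMT hT Ω mΩ μ hμ ℱ θstar A η x h hf
  have : NeZero M := ⟨hM.ne'⟩
  refine ⟨⟨h.integrable_regret hf, h.integral_regret_le hd hMT hT hf⟩, fun ω => ?_⟩
  refine (DisLinUCB.commCost_le_mul hd hT fun n hn i => h.norm_action_le hf hn i ω).trans ?_
  gcongr
  norm_num
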